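/- Let $m,n,r\in\mathbb N$ and let $I\subseteq\{1,\dots,m\}\times\{1,\dots,r\}$, $J\subseteq\{1,\dots,n\}\times\{1,\dots,r\}$ be support constraints. For $k\in\{1,\dots,r\}$ put $\mathcal S_k=\{i : (i,k)\in I\}\times\{j : (j,k)\in J\}$, and let $k\sim l$ if and only if $\mathcal S_k=\mathcal S_l$; for an equivalence class $P$ of $\sim$ write $\mathcal S_P$ for the common value of $\mathcal S_k$, $k\in P$. Assume that $\mathcal S_P\cap\mathcal S_{P'}=\emptyset$ for all distinct classes $P,P'$. For $A\in\mathbb R^{m\times n}$ consider $L(X,Y)=\|A-XY^\top\|_F^2$ as a function on the space $\mathbb R^{|I|+|J|}$ of the pairs $(X,Y)\in\mathbb R^{m\times r}\times\mathbb R^{n\times r}$ with $\operatorname{supp}(X)\subseteq I$ and $\operatorname{supp}(Y)\subseteq J$. Then, for every $A\in\mathbb R^{m\times n}$: 1. $L$ has no spurious local valley: every non-empty path-connected component of a sublevel set $\{L\le\alpha\}$, $\alpha\in\mathbb R$, contains a global minimum of $L$. 2. $L$ has the strict saddle property: $L$ is twice differentiable, and each of its critical points is either a global minimum or a strict saddle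 point, i.e. a critical point at which the Hessian of $L$ is not positive semi-definite. 3. Consequently $L$ has no spurious local minimum: every local minimum of $L$ is a global minimum. -/

import Mathlib

open scoped Matrix

noncomputable section

namespace FSMF

/-! ### Landscape of a real function -/

section Landscape

variable {E : Type*}

/-- `x` is a global minimum of `f`. -/
def IsGlobalMin (f : E → ℝ) (x : E) : Prop := ∀ y, f x ≤ f y

/-- The sublevel set `{x | f x ≤ α}`. -/
def sublevel (f : E → ℝ) (α : ℝ) : Set E := {x | f x ≤ α}

/-- `x` is a local minimum that is not a global minimum. -/
def IsSpuriousLocalMin [TopologicalSpace E] (f : E → ℝ) (x : E) : Prop :=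
  IsLocalMin f x ∧ ¬ IsGlobalMin f x

/-- `S` is a local valley of `f`: a non-empty path-connected component (a maximal path-connected
subset) of some sublevel set. Non-emptiness is part of `IsPathConnected`. -/
def IsLocalValley [TopologicalSpace E] (f : E → ℝ) (S : Set E) : Prop :=
  ∃ α : ℝ, Maximal (fun T : Set E => T ⊆ sublevel f α ∧ IsPathConnected T) S

/-- `S` is a local valley that contains no global minimum. -/
def IsSpuriousLocalValley [TopologicalSpace E] (f : E → ℝ) (S : Set E) : Prop :=
  IsLocalValley f S ∧ ∀ x ∈ S, ¬ IsGlobalMin f x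

variable [NormedAddCommGroup E] [NormedSpace ℝ E]

/-- `x` is a critical point of `f` (meant for differentiable `f`). -/
def IsCriticalPt (f : E → ℝ) (x : E) : Prop := fderiv ℝ f x = 0

/-- The Hessian of `f` at `x`, as a bilinear form (meant for twice differentiable `f`). -/
def hessian (f : E → ℝ) (x : E) : E →L[ℝ] E →L[ℝ] ℝ := fderiv ℝ (fderiv ℝ f) x

/-- `x` is a critical point at which the Hessian is not positive semi-definite. -/
def IsStrictSaddle (f : E → ℝ) (x : E) : Prop :=
  IsCriticalPt f x ∧ ∃ v : E, hessian f x v v < 0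

/-- `f` is twice differentiable, and each of its critical points is a global minimum or a strict
saddle point. -/
def StrictSaddleProperty (f : E → ℝ) : Prop :=
  Differentiable ℝ f ∧ Differentiable ℝ (fderiv ℝ f) ∧
    ∀ x, IsCriticalPt f x → IsGlobalMin f x ∨ IsStrictSaddle f x

end Landscape

/-! ### Matrix factorization with fixed supports -/

section Factorization

variable {m n r : ℕ}

/-- The support of a matrix. -/
def matSupp {p q : ℕ} (X : Matrix (Fin p) (Fin q) ℝ) : Set (Fin p × Fin q) :=
  {e | X e.1 e.2 ≠ 0}

/-- The squared Frobenius norm. -/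
def frobSq {p q : ℕ} (M : Matrix (Fin p) (Fin q) ℝ) : ℝ := ∑ i, ∑ j, M i j ^ 2

/-- The parameter space `ℝ^{|I| + |J|}`: the free coefficients of `X` and of `Y`. -/
abbrev Param (I : Finset (Fin m × Fin r)) (J : Finset (Fin n × Fin r)) : Type :=
  EuclideanSpace ℝ (↥I ⊕ ↥J)

variable {I : Finset (Fin m × Fin r)} {J : Finset (Fin n × Fin r)}

/-- The left factor `X`: its coefficients on `I` are the parameters, the others vanish. -/
def leftFactor (θ : Param I J) : Matrix (Fin m) (Fin r) ℝ :=
  Matrix.of fun i k => if h : (i, k) ∈ I then θ (Sum.inl ⟨(i, k), h⟩) else 0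

/-- The right factor `Y`: its coefficients on `J` are the parameters, the others vanish. -/
def rightFactor (θ : Param I J) : Matrix (Fin n) (Fin r) ℝ :=
  Matrix.of fun j k => if h : (j, k) ∈ J then θ (Sum.inr ⟨(j, k), h⟩) else 0

/-- The parameters are in bijection with the feasible pairs, that is, the pairs `(X, Y)` with
`supp X ⊆ I` and `supp Y ⊆ J`. -/
theorem factors_bijOn :
    Set.BijOn (fun θ : Param I J => (leftFactor θ, rightFactor θ)) Set.univ
      {p : Matrix (Fin m) (Fin r) ℝ × Matrix (Fin n) (Fin r) ℝ |
        matSupp p.1 ⊆ (I : Set (Fin m × Fin r)) ∧ matSupp p.2 ⊆ (J : Set (Fin n × Fin r))} := by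
  refine ⟨fun θ _ => ⟨fun e he => ?_, fun e he => ?_⟩, fun θ _ θ' _ h => ?_, fun p hp => ?_⟩
  · by_contra hI
    exact he (dif_neg (Finset.mem_coe.not.1 hI))
  · by_contra hJ
    exact he (dif_neg (Finset.mem_coe.not.1 hJ))
  · obtain ⟨h1, h2⟩ := Prod.ext_iff.1 h
    ext s
    rcases s with ⟨⟨i, k⟩, hs⟩ | ⟨⟨j, k⟩, hs⟩
    · have := congrFun (congrFun h1 i) k
      simpa [leftFactor, hs] using this
    · have := congrFun (congrFun h2 j) k
      simpa [rightFactor, hs] using this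
  · refine ⟨WithLp.toLp 2 (Sum.elim (fun e => p.1 e.1.1 e.1.2) fun e => p.2 e.1.1 e.1.2),
      trivial, Prod.ext ?_ ?_⟩
    · ext i k
      by_cases h : (i, k) ∈ I
      · simp [leftFactor, h]
      · have h0 : p.1 i k = 0 := by
          by_contra hne
          exact h (hp.1 (show (i, k) ∈ matSupp p.1 from hne))
        simp [leftFactor, h, h0]
    · ext j k
      by_cases h : (j, k) ∈ J
      · simp [rightFactor, h]
      · have h0 : p.2 j k = 0 := by
          by_contra hne
          exact h (hp.2 (show (j, k) ∈ matSupp p.2 from hne))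
        simp [rightFactor, h, h0]

variable (I J)

/-- The loss `L(X, Y) = ‖A - X Yᵀ‖²` on the space of pairs with supports in `I` and `J`. -/
def loss (A : Matrix (Fin m) (Fin n) ℝ) (θ : Param I J) : ℝ :=
  frobSq (A - leftFactor θ * (rightFactor θ)ᵀ)

/-- The support `S_k = supp(I_{•,k}) × supp(J_{•,k})` of the `k`-th rank-one contribution. -/
def rankOneSupp (k : Fin r) : Set (Fin m × Fin n) :=
  {i | (i, k) ∈ I} ×ˢ {j | (j, k) ∈ J}

/-- The equivalence relation `k ∼ l ↔ S_k = S_l` on the column indices. -/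
def suppSetoid : Setoid (Fin r) := Setoid.ker (rankOneSupp I J)

/-- The representative rank-one support `S_P` of an equivalence class `P`. -/
def classSupp (P : Quotient (suppSetoid I J)) : Set (Fin m × Fin n) :=
  Quotient.lift (rankOneSupp I J) (fun _ _ h => h) P

/-- Distinct equivalence classes have disjoint representative rank-one supports. -/
def DisjointSupports : Prop :=
  ∀ P P' : Quotient (suppSetoid I J), P ≠ P' → classSupp I J P ∩ classSupp I J P' = ∅

end Factorization

end FSMF

end

/-! The entries of `X Yᵀ` in a rank-one support `S_P` involve only the columns in `P`, by
disjointness, and outside all supports `X Yᵀ` vanishes. So the loss is a constant plus a sum of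
unconstrained losses `‖A_P - X_P Y_Pᵀ‖²` in separate variables (`isSumOfBlocks_loss`). It remains to
treat one block and to move the blocks one at a time.

For a block, let `(T, W)` be critical with positive semidefinite Hessian and residual `E = A - T
Wᵀ`. Criticality gives `E W = 0` and `Tᵀ E = 0`. If `T` has a kernel, rank-one test directions force
`E = 0`. Otherwise they yield a constant `c` such that `E Eᵀ ≤ c` on the orthogonal complement of
the range of `T`, while `A Aᵀ ≥ c` as a quadratic form on that range (`HasGap`).

Given the gap, take `X` with `Tᵀ X` invertible, and write `X = T Z + N` with `Tᵀ N = 0`. Shrink `N`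
to `s N`, always taking the least squares `Y`. The loss does not increase as `s` goes from 1 to 0
(`blockLoss_interp_le`), and at `s = 0` it is comparable with the loss at `(T, W)`. This gives both
that `(T, W)` is a global minimum (`IsSecondOrderPt.isGlobalMin`) and a path of controlled loss to a
global minimum (`exists_joinedIn_isGlobalMin_of_lt`).

Hence every point that is not a global minimum has a line along which the loss is a quartic with
nonzero slope or negative curvature (`HasDescentLine`). This gives the strict saddle property and
excludes spurious local minima; the paths exclude spurious valleys. -/

open scoped Matrix

namespace FSMF
open Matrix

/-! ### Frobenius norm, second order conditions and the spectral gap -/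

section Block

variable {ρ κ γ : Type*} [Fintype ρ] [Fintype κ] [Fintype γ]

/-- The squared Frobenius norm of a real matrix with arbitrary finite index types. -/
def sqNorm (M : Matrix ρ γ ℝ) : ℝ := trace (Mᵀ * M)

theorem sqNorm_eq_sum (M : Matrix ρ γ ℝ) : sqNorm M = ∑ i, ∑ j, M i j ^ 2 := by
  rw [Finset.sum_comm]
  simp [sqNorm, trace, mul_apply, pow_two]

theorem sqNorm_nonneg (M : Matrix ρ γ ℝ) : 0 ≤ sqNorm M := by
  rw [sqNorm_eq_sum]; positivity

theorem sqNorm_eq_zero {M : Matrix ρ γ ℝ} (h : sqNorm M = 0) : M = 0 := by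
  rw [sqNorm, ← conjTranspose_eq_transpose_of_trivial] at h
  exact trace_conjTranspose_mul_self_eq_zero_iff.1 h

theorem sqNorm_zero : sqNorm (0 : Matrix ρ γ ℝ) = 0 := by simp [sqNorm]

theorem trace_transpose_mul_comm (M N : Matrix ρ γ ℝ) : trace (Mᵀ * N) = trace (Nᵀ * M) := by
  rw [← trace_transpose, transpose_mul, transpose_transpose]

theorem sqNorm_add (M N : Matrix ρ γ ℝ) :
    sqNorm (M + N) = sqNorm M + 2 * trace (Mᵀ * N) + sqNorm N := by
  simp only [sqNorm, transpose_add, Matrix.add_mul, Matrix.mul_add, trace_add]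
  rw [trace_transpose_mul_comm N M]; ring

theorem sqNorm_smul (c : ℝ) (M : Matrix ρ γ ℝ) : sqNorm (c • M) = c ^ 2 * sqNorm M := by
  simp only [sqNorm, transpose_smul, Matrix.smul_mul, Matrix.mul_smul, trace_smul, smul_eq_mul]
  ring

theorem sqNorm_vecMulVec (u : ρ → ℝ) (v : γ → ℝ) :
    sqNorm (vecMulVec u v) = (u ⬝ᵥ u) * (v ⬝ᵥ v) := by
  simp [sqNorm, transpose_vecMulVec, vecMulVec_mul_vecMulVec, trace_vecMulVec]

theorem sqNorm_convex (M N : Matrix ρ γ ℝ) {s : ℝ} (h0 : 0 ≤ s) (h1 : s ≤ 1) :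
    sqNorm ((1 - s) • M + s • N) ≤ (1 - s) * sqNorm M + s * sqNorm N := by
  have h := sqNorm_nonneg (M - N)
  rw [sub_eq_add_neg, sqNorm_add] at h
  rw [sqNorm_add, sqNorm_smul, sqNorm_smul]
  have e : sqNorm (-N) = sqNorm N := by simp [sqNorm]
  simp only [e, transpose_smul, Matrix.smul_mul, Matrix.mul_smul, Matrix.mul_neg, trace_neg,
    trace_smul, smul_eq_mul] at h ⊢
  nlinarith [mul_nonneg (mul_nonneg h0 (sub_nonneg.2 h1)) h]

/-- The unconstrained factorization loss `‖A - X Yᵀ‖²`. -/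
def blockLoss (A : Matrix ρ γ ℝ) (z : Matrix ρ κ ℝ × Matrix γ κ ℝ) : ℝ :=
  sqNorm (A - z.1 * z.2ᵀ)

theorem blockLoss_nonneg (A : Matrix ρ γ ℝ) (z : Matrix ρ κ ℝ × Matrix γ κ ℝ) :
    0 ≤ blockLoss A z := sqNorm_nonneg _

theorem continuous_blockLoss (A : Matrix ρ γ ℝ) :
    Continuous (blockLoss A : Matrix ρ κ ℝ × Matrix γ κ ℝ → ℝ) := by
  unfold blockLoss sqNorm
  fun_prop

theorem blockLoss_line (A : Matrix ρ γ ℝ) (X U : Matrix ρ κ ℝ) (Y V : Matrix γ κ ℝ) (t : ℝ) :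
    blockLoss A ((X, Y) + t • (U, V)) = blockLoss A (X, Y)
      + t * (-2 * trace ((A - X * Yᵀ)ᵀ * (U * Yᵀ + X * Vᵀ)))
      + t ^ 2 * (sqNorm (U * Yᵀ + X * Vᵀ) - 2 * trace ((A - X * Yᵀ)ᵀ * (U * Vᵀ)))
      + t ^ 3 * (2 * trace ((U * Yᵀ + X * Vᵀ)ᵀ * (U * Vᵀ))) + t ^ 4 * sqNorm (U * Vᵀ) := by
  have e : A - ((X, Y) + t • (U, V)).1 * ((X, Y) + t • (U, V)).2ᵀ
      = ((A - X * Yᵀ) + (-t) • (U * Yᵀ + X * Vᵀ)) + (-t ^ 2) • (U * Vᵀ) := by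
    simp only [Prod.fst_add, Prod.snd_add, Prod.smul_fst, Prod.smul_snd, transpose_add,
      transpose_smul, Matrix.add_mul, Matrix.mul_add, Matrix.smul_mul, Matrix.mul_smul]
    module
  rw [blockLoss, e, sqNorm_add, sqNorm_add, sqNorm_smul, sqNorm_smul]
  simp only [blockLoss, transpose_add, transpose_smul, Matrix.add_mul, Matrix.smul_mul,
    Matrix.mul_smul, trace_add, trace_smul, smul_eq_mul, Matrix.mul_add]
  ring

/-- `(X, Y)` is a critical point of the factorization loss with positive semidefinite Hessian. -/
def IsSecondOrderPt (A : Matrix ρ γ ℝ) (X : Matrix ρ κ ℝ) (Y : Matrix γ κ ℝ) : Prop :=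
  ∀ (U : Matrix ρ κ ℝ) (V : Matrix γ κ ℝ),
    trace ((A - X * Yᵀ)ᵀ * (U * Yᵀ + X * Vᵀ)) = 0 ∧
    0 ≤ sqNorm (U * Yᵀ + X * Vᵀ) - 2 * trace ((A - X * Yᵀ)ᵀ * (U * Vᵀ))

variable {A : Matrix ρ γ ℝ} {X : Matrix ρ κ ℝ} {Y : Matrix γ κ ℝ}

/-- With `E` the residual, the direction `U = E Y`, `V = 0` turns the first order condition into `‖E
Y‖² = 0`. -/
theorem IsSecondOrderPt.residual_mul_right (h : IsSecondOrderPt A X Y) : (A - X * Yᵀ) * Y = 0 := by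
  have := (h ((A - X * Yᵀ) * Y) 0).1
  apply sqNorm_eq_zero
  rw [sqNorm, transpose_mul, Matrix.mul_assoc, trace_mul_comm]
  simpa [Matrix.mul_assoc] using this

theorem IsSecondOrderPt.left_mul_residual (h : IsSecondOrderPt A X Y) : Xᵀ * (A - X * Yᵀ) = 0 := by
  have := (h 0 ((A - X * Yᵀ)ᵀ * X)).1
  apply sqNorm_eq_zero
  rw [sqNorm, transpose_mul, transpose_transpose]
  simpa [Matrix.mul_assoc] using this

theorem trace_mul_vecMulVec (E : Matrix ρ γ ℝ) (u : ρ → ℝ) (v : γ → ℝ) :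
    trace (Eᵀ * vecMulVec u v) = (Eᵀ *ᵥ u) ⬝ᵥ v := by
  rw [mul_vecMulVec, trace_vecMulVec]

theorem IsSecondOrderPt.rankOne (h : IsSecondOrderPt A X Y) (u : ρ → ℝ) (v : γ → ℝ)
    (a c : κ → ℝ) :
    0 ≤ (u ⬝ᵥ u) * ((Y *ᵥ a) ⬝ᵥ (Y *ᵥ a)) + 2 * ((u ⬝ᵥ (X *ᵥ c)) * ((Y *ᵥ a) ⬝ᵥ v))
      + ((X *ᵥ c) ⬝ᵥ (X *ᵥ c)) * (v ⬝ᵥ v)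
      - 2 * ((a ⬝ᵥ c) * (((A - X * Yᵀ)ᵀ *ᵥ u) ⬝ᵥ v)) := by
  have h2 := (h (vecMulVec u a) (vecMulVec v c)).2
  have e1 : vecMulVec u a * Yᵀ = vecMulVec u (Y *ᵥ a) := by
    rw [vecMulVec_mul, vecMul_transpose]
  have e2 : X * (vecMulVec v c)ᵀ = vecMulVec (X *ᵥ c) v := by
    rw [transpose_vecMulVec, mul_vecMulVec]
  have e3 : vecMulVec u a * (vecMulVec v c)ᵀ = (a ⬝ᵥ c) • vecMulVec u v := by
    rw [transpose_vecMulVec, vecMulVec_mul_vecMulVec, vecMulVec_smul]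
  have e4 : trace ((vecMulVec u (Y *ᵥ a))ᵀ * vecMulVec (X *ᵥ c) v)
      = (u ⬝ᵥ (X *ᵥ c)) * ((Y *ᵥ a) ⬝ᵥ v) := by
    rw [transpose_vecMulVec, vecMulVec_mul_vecMulVec, trace_vecMulVec, dotProduct_smul,
      smul_eq_mul]
  rw [e1, e2, e3, sqNorm_add, sqNorm_vecMulVec, sqNorm_vecMulVec, e4, Matrix.mul_smul,
    trace_smul, trace_mul_vecMulVec, smul_eq_mul] at h2
  exact h2

theorem dotProduct_self_nonneg' {ι : Type*} [Fintype ι] (v : ι → ℝ) : 0 ≤ v ⬝ᵥ v :=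
  Finset.sum_nonneg fun i _ => mul_self_nonneg (v i)

theorem dotProduct_self_pos' {ι : Type*} [Fintype ι] {v : ι → ℝ} (h : v ≠ 0) : 0 < v ⬝ᵥ v :=
  lt_of_le_of_ne (dotProduct_self_nonneg' v) fun h' => h (dotProduct_self_eq_zero.1 h'.symm)

/-- For `U = u wᵀ` and `V = v wᵀ` with `X w = 0`, the Hessian form is affine in `v`. Being
nonnegative for all `v`, it has no linear part, so the residual vanishes. -/
theorem IsSecondOrderPt.residual_eq_zero (h : IsSecondOrderPt A X Y) {w : κ → ℝ} (hw : w ≠ 0)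
    (hXw : X *ᵥ w = 0) : A - X * Yᵀ = 0 := by
  have hw' := dotProduct_self_pos' hw
  have key : ∀ u : ρ → ℝ, (A - X * Yᵀ)ᵀ *ᵥ u = 0 := by
    intro u
    set e := (A - X * Yᵀ)ᵀ *ᵥ u with he
    by_contra hne
    have hpos := dotProduct_self_pos' hne
    set q := (u ⬝ᵥ u) * ((Y *ᵥ w) ⬝ᵥ (Y *ᵥ w)) with hq
    -- The factor in front of `e` makes the form equal to `q - (q + 1) = -1`.
    have := h.rankOne u (((q + 1) / (2 * (w ⬝ᵥ w) * (e ⬝ᵥ e))) • e) w w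
    rw [hXw, ← he, ← hq] at this
    simp only [dotProduct_zero, dotProduct_smul, smul_eq_mul] at this
    have e2 : 2 * ((w ⬝ᵥ w) * ((q + 1) / (2 * (w ⬝ᵥ w) * (e ⬝ᵥ e)) * (e ⬝ᵥ e))) = q + 1 := by
      field_simp
    linarith
  have : (A - X * Yᵀ)ᵀ = 0 := by
    classical
    apply Matrix.ext_of_mulVec_single
    intro i
    rw [key, zero_mulVec]
  simpa using congrArg transpose this

theorem dotProduct_mulVec_mulVec {ι : Type*} [Fintype ι] (M : Matrix ρ κ ℝ) (N : Matrix ρ ι ℝ)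
    (a : κ → ℝ) (b : ι → ℝ) : (M *ᵥ a) ⬝ᵥ (N *ᵥ b) = a ⬝ᵥ ((Mᵀ * N) *ᵥ b) := by
  rw [← mulVec_mulVec, dotProduct_mulVec a, vecMul_transpose]

/-- The directions are `U = z (Xᵀ X a)ᵀ` and `V = (Eᵀ z) aᵀ`, with `E` the residual. The cross term
vanishes because `z` is orthogonal to the range of `X`. -/
theorem IsSecondOrderPt.gap (h : IsSecondOrderPt A X Y) {z : ρ → ℝ} (hz : Xᵀ *ᵥ z = 0)
    (a : κ → ℝ) :
    (((A - X * Yᵀ)ᵀ *ᵥ z) ⬝ᵥ ((A - X * Yᵀ)ᵀ *ᵥ z)) * ((X *ᵥ a) ⬝ᵥ (X *ᵥ a)) ≤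
      ((Y *ᵥ ((Xᵀ * X) *ᵥ a)) ⬝ᵥ (Y *ᵥ ((Xᵀ * X) *ᵥ a))) * (z ⬝ᵥ z) := by
  have h1 := h.rankOne z ((A - X * Yᵀ)ᵀ *ᵥ z) ((Xᵀ * X) *ᵥ a) a
  have e1 : z ⬝ᵥ (X *ᵥ a) = 0 := by
    rw [dotProduct_mulVec, ← mulVec_transpose, hz, zero_dotProduct]
  have e2 : ((Xᵀ * X) *ᵥ a) ⬝ᵥ a = (X *ᵥ a) ⬝ᵥ (X *ᵥ a) := by
    rw [dotProduct_mulVec_mulVec, dotProduct_comm]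
  rw [e1, e2] at h1
  linarith

/-- The spectral gap condition: the squared norm of the residual transposed, on the orthogonal
complement of the range of `X`, is at most `c`, and that of `(X Yᵀ)ᵀ` on the range of `X` is at
least `c`. -/
def HasGap (A : Matrix ρ γ ℝ) (X : Matrix ρ κ ℝ) (Y : Matrix γ κ ℝ) (c : ℝ) : Prop :=
  (∀ z : ρ → ℝ, Xᵀ *ᵥ z = 0 →
    ((A - X * Yᵀ)ᵀ *ᵥ z) ⬝ᵥ ((A - X * Yᵀ)ᵀ *ᵥ z) ≤ c * (z ⬝ᵥ z)) ∧
  ∀ a : κ → ℝ, c * ((X *ᵥ a) ⬝ᵥ (X *ᵥ a)) ≤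
    (Y *ᵥ ((Xᵀ * X) *ᵥ a)) ⬝ᵥ (Y *ᵥ ((Xᵀ * X) *ᵥ a))

theorem IsSecondOrderPt.exists_hasGap [Nonempty κ] (h : IsSecondOrderPt A X Y)
    (hX : ∀ w, X *ᵥ w = 0 → w = 0) : ∃ c, HasGap A X Y c := by
  set q : (κ → ℝ) → ℝ := fun a => ((Y *ᵥ ((Xᵀ * X) *ᵥ a)) ⬝ᵥ (Y *ᵥ ((Xᵀ * X) *ᵥ a))) /
    ((X *ᵥ a) ⬝ᵥ (X *ᵥ a)) with hq
  have hpos : ∀ a : κ → ℝ, a ≠ 0 → 0 < (X *ᵥ a) ⬝ᵥ (X *ᵥ a) := fun a ha =>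
    dotProduct_self_pos' fun h0 => ha (hX a h0)
  -- By `gap`, each value of `q` bounds each quotient `‖Eᵀ z‖² / ‖z‖²`, so the infimum of `q`
  -- separates the two families.
  refine ⟨sInf (q '' {a | a ≠ 0}), fun z hz => ?_, fun a => ?_⟩
  · rcases eq_or_ne z 0 with rfl | hz0
    · simp
    have hzp := dotProduct_self_pos' hz0
    rw [← div_le_iff₀ hzp]
    apply le_csInf
    · exact ⟨_, ⟨1, one_ne_zero, rfl⟩⟩
    · rintro _ ⟨a, ha, rfl⟩
      rw [hq, div_le_div_iff₀ hzp (hpos a ha)]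
      exact h.gap hz a
  · rcases eq_or_ne a 0 with rfl | ha
    · simp
    rw [← le_div_iff₀ (hpos a ha)]
    apply csInf_le
    · refine ⟨0, ?_⟩
      rintro _ ⟨b, -, rfl⟩
      exact div_nonneg (dotProduct_self_nonneg' _) (dotProduct_self_nonneg' _)
    · exact ⟨a, ha, rfl⟩

theorem posDef_gram {X : Matrix ρ κ ℝ} (hX : ∀ w, X *ᵥ w = 0 → w = 0) : (Xᵀ * X).PosDef := by
  rw [← conjTranspose_eq_transpose_of_trivial]
  refine PosDef.conjTranspose_mul_self X fun v w h => ?_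
  have := hX (v - w) (by rw [mulVec_sub]; exact sub_eq_zero.2 h)
  exact sub_eq_zero.1 this

theorem posSemidef_of_forall {M : Matrix κ κ ℝ} (hM : Mᵀ = M) (h : ∀ w, 0 ≤ w ⬝ᵥ (M *ᵥ w)) :
    M.PosSemidef :=
  .of_dotProduct_mulVec_nonneg (by rw [IsHermitian, conjTranspose_eq_transpose_of_trivial, hM])
    (by simpa using h)

theorem sqNorm_add_left_mul {E : Matrix ρ γ ℝ} (hE : Xᵀ * E = 0) (Z : Matrix κ γ ℝ) :
    sqNorm (E + X * Z) = sqNorm E + sqNorm (X * Z) := by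
  have : Eᵀ * (X * Z) = 0 := by
    rw [← Matrix.mul_assoc, ← transpose_transpose X, ← transpose_mul, hE, transpose_zero,
      Matrix.zero_mul]
  rw [sqNorm_add, this, trace_zero]; ring

theorem isGlobalMin_of_residual_eq_zero (h : A - X * Yᵀ = 0) :
    IsGlobalMin (blockLoss A) (X, Y) := fun z => by
  rw [blockLoss, h, sqNorm_zero]
  exact blockLoss_nonneg A z

/-- When the residual is orthogonal to the range of `X`, Pythagoras shows that no left factor with
columns in that range does better. -/
theorem blockLoss_le_blockLoss_left_mul (h : Xᵀ * (A - X * Yᵀ) = 0) (Z : Matrix κ κ ℝ)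
    (Y' : Matrix γ κ ℝ) : blockLoss A (X, Y) ≤ blockLoss A (X * Z, Y') := by
  have := sqNorm_add_left_mul h (Yᵀ - Z * Y'ᵀ)
  have e : A - X * Yᵀ + X * (Yᵀ - Z * Y'ᵀ) = A - X * Z * Y'ᵀ := by
    rw [Matrix.mul_sub, Matrix.mul_assoc]; abel
  rw [e] at this
  simp only [blockLoss]
  rw [this]
  linarith [sqNorm_nonneg (X * (Yᵀ - Z * Y'ᵀ))]

end Block

/-! ### Positive semidefinite matrices: traces and monotonicity of the inverse -/

section PosSemidef

variable {κ : Type*} [Fintype κ] [DecidableEq κ]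

open scoped MatrixOrder Matrix.Norms.L2Operator in
theorem trace_mul_nonneg {R C : Matrix κ κ ℝ} (hR : R.PosSemidef) (hC : C.PosSemidef) :
    0 ≤ trace (R * C) := by
  obtain ⟨B, rfl⟩ := CStarAlgebra.nonneg_iff_eq_star_mul_self.mp hC.nonneg
  rw [← Matrix.mul_assoc, trace_mul_comm, ← Matrix.mul_assoc]
  exact (hR.mul_mul_conjTranspose_same B).trace_nonneg

theorem inv_sub_smul_inv_posSemidef {G H : Matrix κ κ ℝ} (hG : G.PosDef) (hH : H.PosDef) {a : ℝ}
    (ha : 0 ≤ a) (h : (H - a • G).PosSemidef) : (G⁻¹ - a • H⁻¹).PosSemidef := by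
  have uG : IsUnit G.det := (isUnit_iff_isUnit_det G).1 hG.isUnit
  have uH : IsUnit H.det := (isUnit_iff_isUnit_det H).1 hH.isUnit
  have hGi := hG.inv.isHermitian
  have hHi := hH.inv.isHermitian
  have hD : (G⁻¹ - a • H⁻¹)ᴴ = G⁻¹ - a • H⁻¹ := by
    rw [conjTranspose_sub, conjTranspose_smul, hGi.eq, hHi.eq]; simp
  -- This identity writes the difference as a sum of two congruences of positive semidefinite
  -- matrices.
  have e : G⁻¹ - a • H⁻¹ = (G⁻¹ - a • H⁻¹)ᴴ * G * (G⁻¹ - a • H⁻¹)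
      + a • ((H⁻¹)ᴴ * (H - a • G) * H⁻¹) := by
    rw [hD, hHi.eq]
    simp only [Matrix.sub_mul, Matrix.mul_sub, Matrix.smul_mul, Matrix.mul_smul,
      nonsing_inv_mul _ uG, nonsing_inv_mul _ uH, Matrix.one_mul, Matrix.mul_assoc,
      mul_nonsing_inv _ uG, Matrix.mul_one]
    module
  rw [e]
  exact (hG.posSemidef.conjTranspose_mul_mul_same _).add
    ((h.conjTranspose_mul_mul_same _).smul ha)

end PosSemidef

/-! ### Elimination of the right factor and monotonicity along the interpolation -/

section Block

variable {ρ κ γ : Type*} [Fintype ρ] [Fintype κ] [DecidableEq κ]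

/-- The least squares solution `Y` of `A ≈ X Yᵀ`. -/
noncomputable def bestRight (A : Matrix ρ γ ℝ) (X : Matrix ρ κ ℝ) : Matrix γ κ ℝ := Aᵀ * X * (Xᵀ * X)⁻¹

theorem bestRight_transpose (A : Matrix ρ γ ℝ) (X : Matrix ρ κ ℝ) :
    (bestRight A X)ᵀ = (Xᵀ * X)⁻¹ * (Xᵀ * A) := by
  rw [bestRight, transpose_mul, transpose_nonsing_inv, transpose_mul, transpose_mul,
    transpose_transpose, transpose_transpose]

variable (A : Matrix ρ γ ℝ) {X : Matrix ρ κ ℝ}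

theorem left_mul_residual_bestRight (hX : IsUnit (Xᵀ * X).det) :
    Xᵀ * (A - X * (bestRight A X)ᵀ) = 0 := by
  rw [bestRight_transpose, Matrix.mul_sub, ← Matrix.mul_assoc, ← Matrix.mul_assoc,
    mul_nonsing_inv _ hX, Matrix.one_mul, sub_self]

variable [Fintype γ]

theorem blockLoss_eq_bestRight (hX : IsUnit (Xᵀ * X).det) (Y : Matrix γ κ ℝ) :
    blockLoss A (X, Y) = blockLoss A (X, bestRight A X) +
      sqNorm (X * ((bestRight A X)ᵀ - Yᵀ)) := by
  rw [blockLoss, blockLoss, ← sqNorm_add_left_mul (left_mul_residual_bestRight A hX)]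
  congr 1
  rw [Matrix.mul_sub]; abel

theorem blockLoss_bestRight_le (hX : IsUnit (Xᵀ * X).det) (Y : Matrix γ κ ℝ) :
    blockLoss A (X, bestRight A X) ≤ blockLoss A (X, Y) := by
  rw [blockLoss_eq_bestRight A hX Y]
  linarith [sqNorm_nonneg (X * ((bestRight A X)ᵀ - Yᵀ))]

theorem blockLoss_bestRight (hX : IsUnit (Xᵀ * X).det) :
    blockLoss A (X, bestRight A X) =
      sqNorm A - trace ((Xᵀ * X)⁻¹ * ((Xᵀ * A) * (Xᵀ * A)ᵀ)) := by
  have h := blockLoss_eq_bestRight A hX 0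
  have e : sqNorm (X * (bestRight A X)ᵀ) = trace ((Xᵀ * X)⁻¹ * ((Xᵀ * A) * (Xᵀ * A)ᵀ)) := by
    rw [sqNorm, transpose_mul, transpose_transpose, Matrix.mul_assoc, ← Matrix.mul_assoc Xᵀ,
      bestRight_transpose, ← Matrix.mul_assoc (Xᵀ * X), mul_nonsing_inv _ hX, Matrix.one_mul,
      bestRight, trace_mul_comm, transpose_mul, transpose_transpose, ← Matrix.mul_assoc,
      trace_mul_comm, Matrix.mul_assoc]
  rw [← e]
  simp only [blockLoss, transpose_zero, Matrix.mul_zero, sub_zero] at h ⊢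
  linarith

/-- The interpolation between `X` (at `s = 1`) and its orthogonal projection to the range of
`T` (at `s = 0`). -/
noncomputable def interp (T X : Matrix ρ κ ℝ) (s : ℝ) : Matrix ρ κ ℝ :=
  T * ((Tᵀ * T)⁻¹ * (Tᵀ * X)) + s • (X - T * ((Tᵀ * T)⁻¹ * (Tᵀ * X)))

theorem interp_zero (T X : Matrix ρ κ ℝ) : interp T X 0 = T * ((Tᵀ * T)⁻¹ * (Tᵀ * X)) := by
  simp [interp]

theorem interp_one (T X : Matrix ρ κ ℝ) : interp T X 1 = X := by simp [interp]

variable {A} {T : Matrix ρ κ ℝ} {W : Matrix γ κ ℝ}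

theorem transpose_mul_interp (hT : IsUnit (Tᵀ * T).det) (X : Matrix ρ κ ℝ) (s : ℝ) :
    Tᵀ * interp T X s = Tᵀ * X := by
  simp only [interp, Matrix.mul_add, Matrix.mul_smul, Matrix.mul_sub]
  rw [← Matrix.mul_assoc Tᵀ, ← Matrix.mul_assoc (Tᵀ * T), mul_nonsing_inv _ hT, Matrix.one_mul,
    sub_self, smul_zero, add_zero]

/-- `Tᵀ X_s` does not depend on `s`, so its invertibility keeps every `X_s` injective. -/
theorem posDef_gram_interp (hT : IsUnit (Tᵀ * T).det) (hX : IsUnit (Tᵀ * X).det) (s : ℝ) :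
    ((interp T X s)ᵀ * interp T X s).PosDef := by
  refine posDef_gram fun w hw => ?_
  have h : (Tᵀ * X) *ᵥ w = 0 := by
    rw [← transpose_mul_interp hT X s, ← mulVec_mulVec, hw, mulVec_zero]
  have := congrArg ((Tᵀ * X)⁻¹ *ᵥ ·) h
  simpa [nonsing_inv_mul _ hX] using this

theorem isUnit_gram_interp (hT : IsUnit (Tᵀ * T).det) (hX : IsUnit (Tᵀ * X).det) (s : ℝ) :
    IsUnit ((interp T X s)ᵀ * interp T X s).det :=
  (isUnit_iff_isUnit_det _).1 (posDef_gram_interp hT hX s).isUnit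

/-- With `G_s = X_sᵀ X_s`, the optimal loss is `‖A‖² - tr (G_s⁻¹ X_sᵀ A Aᵀ X_s)`. Up to a constant
this is `-tr (G_s⁻¹ C₁) + s² tr (G_s⁻¹ C₂)`, where the gap makes `C₁` and `C₂` positive
semidefinite. Since `G_s⁻¹` decreases and `s² G_s⁻¹` increases with `s`, the value at `s` is at most
the value at 1. -/
theorem blockLoss_interp_le {c : ℝ} (hT : IsUnit (Tᵀ * T).det) (hX : IsUnit (Tᵀ * X).det)
    (hTE : Tᵀ * (A - T * Wᵀ) = 0) (hEW : (A - T * Wᵀ) * W = 0) (hc : HasGap A T W c) {s : ℝ}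
    (h0 : 0 ≤ s) (h1 : s ≤ 1) :
    blockLoss A (interp T X s, bestRight A (interp T X s)) ≤
      blockLoss A (X, bestRight A X) := by
  set Z := (Tᵀ * T)⁻¹ * (Tᵀ * X) with hZ
  set N := X - T * Z with hN
  set E := A - T * Wᵀ with hE
  have hTN : Tᵀ * N = 0 := by
    rw [hN, Matrix.mul_sub, ← Matrix.mul_assoc, hZ, ← Matrix.mul_assoc, mul_nonsing_inv _ hT,
      Matrix.one_mul, sub_self]
  have hNT : Nᵀ * T = 0 := by simpa using congrArg transpose hTN
  have hWE : Wᵀ * Eᵀ = 0 := by simpa using congrArg transpose hEW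
  have hA : A = T * Wᵀ + E := by rw [hE]; abel
  set C₁ := Zᵀ * ((Tᵀ * T) * (Wᵀ * (W * ((Tᵀ * T) * Z)))) - c • (Zᵀ * ((Tᵀ * T) * Z)) with hC₁
  set C₂ := c • (Nᵀ * N) - Nᵀ * (E * (Eᵀ * N)) with hC₂
  have gram : ∀ s : ℝ, (interp T X s)ᵀ * interp T X s =
      Zᵀ * ((Tᵀ * T) * Z) + s ^ 2 • (Nᵀ * N) := by
    intro s
    simp only [interp, ← hZ, ← hN, transpose_add, transpose_smul, transpose_mul, Matrix.add_mul,
      Matrix.mul_add, Matrix.smul_mul, Matrix.mul_smul, Matrix.mul_assoc, hTN, Matrix.mul_zero]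
    rw [← Matrix.mul_assoc Nᵀ, hNT]
    simp [smul_smul, pow_two]
  -- Splitting off `c G_s` leaves a constant trace `c |κ|` once multiplied by `G_s⁻¹`.
  have cross : ∀ s : ℝ, ((interp T X s)ᵀ * A) * ((interp T X s)ᵀ * A)ᵀ =
      c • ((interp T X s)ᵀ * interp T X s) + C₁ - s ^ 2 • C₂ := by
    intro s
    have e : (interp T X s)ᵀ * A = Zᵀ * ((Tᵀ * T) * Wᵀ) + s • (Nᵀ * E) := by
      rw [hA]
      simp only [interp, ← hZ, ← hN, transpose_add, transpose_smul, transpose_mul, Matrix.add_mul,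
        Matrix.mul_add, Matrix.smul_mul, Matrix.mul_assoc, hTE, Matrix.mul_zero]
      rw [← Matrix.mul_assoc Nᵀ, hNT]
      simp
    rw [e, gram, hC₁, hC₂]
    have hE1 : ∀ M : Matrix κ κ ℝ, E * (W * M) = 0 := fun M => by
      rw [← Matrix.mul_assoc, hEW, Matrix.zero_mul]
    have hE2 : ∀ M : Matrix ρ κ ℝ, Wᵀ * (Eᵀ * M) = 0 := fun M => by
      rw [← Matrix.mul_assoc, hWE, Matrix.zero_mul]
    simp only [transpose_add, transpose_smul, transpose_mul, transpose_transpose, Matrix.add_mul,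
      Matrix.mul_add, Matrix.smul_mul, Matrix.mul_smul, Matrix.mul_assoc, hE1, hE2,
      Matrix.mul_zero]
    module
  have hC₁' : C₁.PosSemidef := by
    refine posSemidef_of_forall ?_ fun w => ?_
    · simp [hC₁, Matrix.mul_assoc]
    · have := hc.2 (Z *ᵥ w)
      have e1 : w ⬝ᵥ ((Zᵀ * ((Tᵀ * T) * (Wᵀ * (W * ((Tᵀ * T) * Z))))) *ᵥ w) =
          (W *ᵥ ((Tᵀ * T) *ᵥ (Z *ᵥ w))) ⬝ᵥ (W *ᵥ ((Tᵀ * T) *ᵥ (Z *ᵥ w))) := by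
        simp only [mulVec_mulVec]
        rw [dotProduct_mulVec_mulVec]
        simp [Matrix.mul_assoc]
      have e2 : w ⬝ᵥ ((Zᵀ * ((Tᵀ * T) * Z)) *ᵥ w) = (T *ᵥ (Z *ᵥ w)) ⬝ᵥ (T *ᵥ (Z *ᵥ w)) := by
        simp only [mulVec_mulVec]
        rw [dotProduct_mulVec_mulVec]
        simp [Matrix.mul_assoc]
      rw [hC₁, sub_mulVec, smul_mulVec, dotProduct_sub, dotProduct_smul, smul_eq_mul, e1, e2]
      linarith
  have hC₂' : C₂.PosSemidef := by
    refine posSemidef_of_forall ?_ fun w => ?_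
    · simp [hC₂, Matrix.mul_assoc]
    · have := hc.1 (N *ᵥ w) (by rw [mulVec_mulVec, hTN, zero_mulVec])
      have e1 : w ⬝ᵥ ((Nᵀ * (E * (Eᵀ * N))) *ᵥ w) =
          (Eᵀ *ᵥ (N *ᵥ w)) ⬝ᵥ (Eᵀ *ᵥ (N *ᵥ w)) := by
        simp only [mulVec_mulVec]
        rw [dotProduct_mulVec_mulVec]
        simp [Matrix.mul_assoc]
      have e2 : w ⬝ᵥ ((Nᵀ * N) *ᵥ w) = (N *ᵥ w) ⬝ᵥ (N *ᵥ w) := by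
        rw [dotProduct_mulVec_mulVec]
      rw [hC₂, sub_mulVec, smul_mulVec, dotProduct_sub, dotProduct_smul, smul_eq_mul, e1, e2]
      rw [← hE] at this
      linarith
  have hNN : (Nᵀ * N).PosSemidef := by
    rw [← conjTranspose_eq_transpose_of_trivial]; exact posSemidef_conjTranspose_mul_self N
  have hTZ : (Zᵀ * ((Tᵀ * T) * Z)).PosSemidef := by
    have := posSemidef_conjTranspose_mul_self (T * Z)
    simpa [Matrix.mul_assoc] using this
  have value : ∀ s : ℝ, blockLoss A (interp T X s, bestRight A (interp T X s)) =
      sqNorm A - (c * Fintype.card κ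
        + trace (((interp T X s)ᵀ * interp T X s)⁻¹ * C₁)
        - s ^ 2 * trace (((interp T X s)ᵀ * interp T X s)⁻¹ * C₂)) := by
    intro s
    have hu := isUnit_gram_interp hT hX s
    rw [blockLoss_bestRight A hu, cross]
    simp only [Matrix.mul_add, Matrix.mul_sub, Matrix.mul_smul, nonsing_inv_mul _ hu, trace_add,
      trace_sub, trace_smul, trace_one, smul_eq_mul]
  have p1 := posDef_gram_interp hT hX 1
  have ps := posDef_gram_interp hT hX s
  have t1 : 0 ≤ trace ((((interp T X s)ᵀ * interp T X s)⁻¹ -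
      (1 : ℝ) • ((interp T X 1)ᵀ * interp T X 1)⁻¹) * C₁) := by
    refine trace_mul_nonneg (inv_sub_smul_inv_posSemidef ps p1 zero_le_one ?_) hC₁'
    rw [gram, gram]
    have : Zᵀ * ((Tᵀ * T) * Z) + (1 : ℝ) ^ 2 • (Nᵀ * N) - (1 : ℝ) •
        (Zᵀ * ((Tᵀ * T) * Z) + s ^ 2 • (Nᵀ * N)) = (1 - s ^ 2) • (Nᵀ * N) := by module
    rw [this]
    exact hNN.smul (by nlinarith)
  have t2 : 0 ≤ trace ((((interp T X 1)ᵀ * interp T X 1)⁻¹ -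
      (s ^ 2) • ((interp T X s)ᵀ * interp T X s)⁻¹) * C₂) := by
    refine trace_mul_nonneg (inv_sub_smul_inv_posSemidef p1 ps (sq_nonneg s) ?_) hC₂'
    rw [gram, gram]
    have : Zᵀ * ((Tᵀ * T) * Z) + s ^ 2 • (Nᵀ * N) - s ^ 2 •
        (Zᵀ * ((Tᵀ * T) * Z) + (1 : ℝ) ^ 2 • (Nᵀ * N)) = (1 - s ^ 2) • (Zᵀ * ((Tᵀ * T) * Z)) := by
      module
    rw [this]
    exact hTZ.smul (by nlinarith)
  have v1 := value 1
  rw [value s]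
  simp only [Matrix.sub_mul, Matrix.smul_mul, trace_sub, trace_smul, smul_eq_mul,
    interp_one] at t1 t2 v1
  rw [v1]
  linarith

/-- At `s = 0` the left factor is `T` times an invertible matrix, so a suitable right factor
reproduces `T Wᵀ` exactly. -/
theorem blockLoss_interp_zero_le (hT : IsUnit (Tᵀ * T).det) (hX : IsUnit (Tᵀ * X).det) :
    blockLoss A (interp T X 0, bestRight A (interp T X 0)) ≤ blockLoss A (T, W) := by
  refine (blockLoss_bestRight_le A (isUnit_gram_interp hT hX 0)
    (W * ((Tᵀ * X)⁻¹ * (Tᵀ * T))ᵀ)).trans_eq ?_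
  have e : interp T X 0 * (W * ((Tᵀ * X)⁻¹ * (Tᵀ * T))ᵀ)ᵀ = T * Wᵀ := by
    rw [interp_zero, transpose_mul, transpose_transpose]
    simp only [Matrix.mul_assoc]
    rw [← Matrix.mul_assoc Tᵀ X, ← Matrix.mul_assoc (Tᵀ * X), mul_nonsing_inv _ hX,
      Matrix.one_mul, ← Matrix.mul_assoc Tᵀ T, ← Matrix.mul_assoc (Tᵀ * T)⁻¹,
      nonsing_inv_mul _ hT, Matrix.one_mul]
  simp only [blockLoss, e]

/-- All but finitely many shifts of a square matrix by a scalar are invertible. -/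
theorem exists_isUnit_det_add_smul (D : Matrix κ κ ℝ) {δ : ℝ} (hδ : 0 < δ) :
    ∃ t, 0 < t ∧ t < δ ∧ IsUnit (D + t • (1 : Matrix κ κ ℝ)).det := by
  -- `det (D + t)` is the characteristic polynomial of `-D` evaluated at `t`.
  have hfin : {t : ℝ | (-D).charpoly.IsRoot t}.Finite :=
    Polynomial.finite_setOfPred_isRoot (charpoly_monic (-D)).ne_zero
  obtain ⟨t, ht, hn⟩ := ((Set.Ioo_infinite hδ).sdiff hfin).nonempty
  refine ⟨t, ht.1, ht.2, isUnit_iff_ne_zero.2 fun h => hn ?_⟩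
  simp only [Set.mem_ofPred_eq, Polynomial.IsRoot, eval_charpoly]
  rw [← h]
  congr 1
  rw [sub_neg_eq_add, add_comm]
  simp [scalar_apply, smul_one_eq_diagonal]

theorem exists_isUnit_transpose_mul_add (hT : IsUnit (Tᵀ * T).det) (X : Matrix ρ κ ℝ) {δ : ℝ}
    (hδ : 0 < δ) : ∃ t, 0 < t ∧ t < δ ∧ IsUnit (Tᵀ * (X + t • T)).det := by
  obtain ⟨t, h0, h1, ht⟩ := exists_isUnit_det_add_smul ((Tᵀ * T)⁻¹ * (Tᵀ * X)) hδ
  refine ⟨t, h0, h1, ?_⟩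
  have e : Tᵀ * (X + t • T) = (Tᵀ * T) * ((Tᵀ * T)⁻¹ * (Tᵀ * X) + t • (1 : Matrix κ κ ℝ)) := by
    rw [Matrix.mul_add, Matrix.mul_add, ← Matrix.mul_assoc (Tᵀ * T), mul_nonsing_inv _ hT,
      Matrix.one_mul, Matrix.mul_smul, Matrix.mul_smul, Matrix.mul_one]
  rw [e, det_mul]
  exact hT.mul ht

theorem isGlobalMin_of_hasGap {c : ℝ} (hT : IsUnit (Tᵀ * T).det)
    (hTE : Tᵀ * (A - T * Wᵀ) = 0) (hEW : (A - T * Wᵀ) * W = 0) (hc : HasGap A T W c) :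
    IsGlobalMin (blockLoss A) (T, W) := by
  rintro ⟨X, Y⟩
  by_contra! hlt
  -- A small shift of the better point along `T` keeps its loss below that of `(T, W)` and makes `Tᵀ
  -- X` invertible.
  have hcont : Continuous fun t : ℝ => blockLoss A (X + t • T, Y) :=
    (continuous_blockLoss A).comp (by fun_prop)
  have hopen : {t : ℝ | blockLoss A (X + t • T, Y) < blockLoss A (T, W)} ∈ nhds (0 : ℝ) :=
    (isOpen_lt hcont continuous_const).mem_nhds (by simpa using hlt)
  obtain ⟨δ, hδ, hball⟩ := Metric.mem_nhds_iff.1 hopen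
  obtain ⟨t, h0, h1, ht⟩ := exists_isUnit_transpose_mul_add hT X hδ
  have hlt' : blockLoss A (X + t • T, Y) < blockLoss A (T, W) :=
    hball (by simpa [abs_of_pos h0] using h1)
  have hu := isUnit_gram_interp hT ht 1
  rw [interp_one] at hu
  have := blockLoss_interp_le hT ht hTE hEW hc le_rfl zero_le_one
  have h2 := blockLoss_bestRight_le A hu Y
  rw [interp_zero] at this
  have h3 := blockLoss_le_blockLoss_left_mul hTE ((Tᵀ * T)⁻¹ * (Tᵀ * (X + t • T)))
    (bestRight A (T * ((Tᵀ * T)⁻¹ * (Tᵀ * (X + t • T)))))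
  linarith

/-- A second order point either has no residual, or a left factor of full column rank and a
spectral gap. -/
theorem IsSecondOrderPt.alternative [Nonempty κ] (h : IsSecondOrderPt A T W) :
    A - T * Wᵀ = 0 ∨ IsUnit (Tᵀ * T).det ∧ ∃ c, HasGap A T W c := by
  by_cases hT : ∀ w, T *ᵥ w = 0 → w = 0
  · exact Or.inr ⟨(isUnit_iff_isUnit_det _).1 (posDef_gram hT).isUnit, h.exists_hasGap hT⟩
  · push Not at hT
    obtain ⟨w, hw, hw0⟩ := hT
    exact Or.inl (h.residual_eq_zero hw0 hw)

theorem IsSecondOrderPt.isGlobalMin (h : IsSecondOrderPt A T W) :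
    IsGlobalMin (blockLoss A) (T, W) := by
  rcases isEmpty_or_nonempty κ with hκ | hκ
  · intro z
    rw [Subsingleton.elim z (T, W)]
  rcases h.alternative with h0 | ⟨hT, c, hc⟩
  · exact isGlobalMin_of_residual_eq_zero h0
  · exact isGlobalMin_of_hasGap hT h.left_mul_residual h.residual_mul_right hc

end Block

/-! ### Lines of descent -/

section Descent

variable {E : Type*} [AddCommGroup E] [Module ℝ E]

/-- Along some line through `z` the function `f` is a quartic polynomial whose linear coefficient
is nonzero or whose quadratic coefficient is negative. -/
def HasDescentLine (f : E → ℝ) (z : E) : Prop :=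
  ∃ (v : E) (a b c d : ℝ),
    (∀ t : ℝ, f (z + t • v) = f z + t * a + t ^ 2 * b + t ^ 3 * c + t ^ 4 * d) ∧ (a ≠ 0 ∨ b < 0)

theorem HasDescentLine.exists_lt {f : E → ℝ} {z : E} (h : HasDescentLine f z) :
    ∃ (w : E) (δ : ℝ), 0 < δ ∧ ∀ t, 0 < t → t < δ → f (z + t • w) < f z := by
  obtain ⟨v, a, b, c, d, hf, hab⟩ := h
  -- Reversing `v` changes the sign of the odd coefficients only.
  wlog ha : a ≤ 0 generalizing v a c
  · refine this (-v) (-a) (-c) (fun t => ?_) (Or.inl (by intro h; apply ha; linarith))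
      (by linarith)
    have := hf (-t)
    rw [neg_smul, ← smul_neg] at this
    rw [this]; ring
  have near : ∀ p : ℝ → ℝ, Continuous p → p 0 < 0 → ∃ δ > 0, ∀ t, 0 < t → t < δ → p t < 0 := by
    intro p hp h0
    obtain ⟨δ, hδ, hb⟩ := Metric.mem_nhds_iff.1 ((isOpen_lt hp continuous_const).mem_nhds h0)
    exact ⟨δ, hδ, fun t h1 h2 => hb (by simpa [abs_of_pos h1] using h2)⟩
  refine ⟨v, ?_⟩
  rcases ha.lt_or_eq with ha | rfl
  · obtain ⟨δ, hδ, hp⟩ := near (fun t => a + t * b + t ^ 2 * c + t ^ 3 * d) (by fun_prop)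
      (by simpa using ha)
    refine ⟨δ, hδ, fun t h1 h2 => ?_⟩
    rw [hf]
    nlinarith [mul_pos_of_neg_of_neg (hp t h1 h2) (neg_neg_of_pos h1)]
  · have hb : b < 0 := by simpa using hab
    obtain ⟨δ, hδ, hp⟩ := near (fun t => b + t * c + t ^ 2 * d) (by fun_prop) (by simpa using hb)
    refine ⟨δ, hδ, fun t h1 h2 => ?_⟩
    rw [hf]
    nlinarith [mul_pos_of_neg_of_neg (hp t h1 h2) (neg_neg_of_pos (pow_pos h1 2))]

theorem HasDescentLine.not_isLocalMin [TopologicalSpace E] [ContinuousAdd E] [ContinuousSMul ℝ E]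
    {f : E → ℝ} {z : E} (h : HasDescentLine f z) : ¬ IsLocalMin f z := by
  obtain ⟨w, δ, hδ, hlt⟩ := h.exists_lt
  intro hmin
  have hc : Filter.Tendsto (fun t : ℝ => z + t • w) (nhds 0) (nhds z) := by
    have : Continuous fun t : ℝ => z + t • w := by fun_prop
    simpa using this.tendsto 0
  obtain ⟨ε, hε, hb⟩ := Metric.mem_nhds_iff.1 (hc.eventually hmin)
  have h0 : 0 < min δ ε / 2 := by positivity
  have h1 : min δ ε / 2 < δ := by linarith [min_le_left δ ε]
  have h2 : min δ ε / 2 < ε := by linarith [min_le_right δ ε]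
  have h3 : f z ≤ f (z + (min δ ε / 2) • w) :=
    hb (show min δ ε / 2 ∈ Metric.ball 0 ε by
      rwa [Metric.mem_ball, Real.dist_eq, sub_zero, abs_of_pos h0])
  linarith [hlt _ h0 h1]

theorem joinedIn_sublevel_add [TopologicalSpace E] [ContinuousAdd E] [ContinuousSMul ℝ E]
    {f : E → ℝ} {z w : E} {α : ℝ} (h : ∀ s : ℝ, 0 ≤ s → s ≤ 1 → f (z + s • w) ≤ α) :
    JoinedIn (sublevel f α) z (z + w) := by
  refine JoinedIn.ofLine (f := fun s : ℝ => z + s • w) (by fun_prop) (by simp) (by simp) ?_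
  rintro _ ⟨s, hs, rfl⟩
  exact h s hs.1 hs.2

end Descent

/-! ### Orthogonal projections and existence of a global minimum -/

section Projection

variable {ρ κ γ : Type*} [Fintype ρ] [Fintype κ] [Fintype γ]

/-- The orthogonal projection to the range of `X` has the form `B Bᵀ` with `B` of the shape of
`X`. -/
theorem exists_projection (X : Matrix ρ κ ℝ) :
    ∃ (B : Matrix ρ κ ℝ) (C : Matrix κ κ ℝ), (B * Bᵀ) * (B * Bᵀ) = B * Bᵀ ∧ B * Bᵀ * X = X ∧
      B = X * C := by
  classical
  set x : κ → EuclideanSpace ℝ ρ := fun k => WithLp.toLp 2 (fun i => X i k) with hx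
  set V := Submodule.span ℝ (Set.range x) with hV
  let b := stdOrthonormalBasis ℝ V
  have hd : Module.finrank ℝ V ≤ Fintype.card κ := finrank_range_le_card x
  -- An orthonormal basis of the column span has at most as many vectors as there are columns; `P`
  -- pads it with zero columns.
  obtain ⟨e⟩ : Nonempty (Fin (Module.finrank ℝ V) ↪ κ) :=
    Function.Embedding.nonempty_of_card_le (by simpa using hd)
  set B₀ : Matrix ρ (Fin (Module.finrank ℝ V)) ℝ :=
    Matrix.of fun i l => (b l : EuclideanSpace ℝ ρ) i with hB₀
  set P : Matrix (Fin (Module.finrank ℝ V)) κ ℝ := Matrix.of fun l k => if e l = k then 1 else 0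
    with hP
  have hBB : B₀ᵀ * B₀ = 1 := by
    ext l l'
    have := (orthonormal_iff_ite.1 b.orthonormal) l' l
    rw [Submodule.coe_inner, PiLp.inner_apply] at this
    simp only [mul_apply, transpose_apply, hB₀, of_apply, one_apply]
    simpa [eq_comm] using this
  have hPP : P * Pᵀ = 1 := by
    ext l l'
    simp [mul_apply, hP, one_apply, eq_comm]
  have hX : B₀ * (B₀ᵀ * X) = X := by
    ext i k
    have hk : x k ∈ V := Submodule.subset_span ⟨k, rfl⟩
    have h1 := b.sum_repr' ⟨x k, hk⟩
    have h2 := congrArg (fun v : V => (v : EuclideanSpace ℝ ρ) i) h1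
    simp only [Submodule.coe_sum, Submodule.coe_smul, Submodule.coe_inner, PiLp.inner_apply,
      WithLp.ofLp_sum, WithLp.ofLp_smul, Finset.sum_apply, Pi.smul_apply, smul_eq_mul] at h2
    simp only [mul_apply, transpose_apply, hB₀, of_apply]
    rw [show X i k = (x k) i from rfl, ← h2]
    refine Finset.sum_congr rfl fun l _ => ?_
    rw [mul_comm]
    simp [hx, mul_comm]
  have hC : ∀ l, ∃ c : κ → ℝ, ∑ k, c k • x k = (b l : EuclideanSpace ℝ ρ) := fun l =>
    (Submodule.mem_span_range_iff_exists_fun ℝ).1 (b l).2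
  choose c hc using hC
  have hBP : (B₀ * P) * (B₀ * P)ᵀ = B₀ * B₀ᵀ := by
    rw [transpose_mul, Matrix.mul_assoc, ← Matrix.mul_assoc P, hPP, Matrix.one_mul]
  refine ⟨B₀ * P, (Matrix.of fun k l => c l k) * P, ?_, ?_, ?_⟩
  · rw [hBP, Matrix.mul_assoc, ← Matrix.mul_assoc B₀ᵀ, hBB, Matrix.one_mul]
  · rw [hBP, Matrix.mul_assoc, hX]
  · rw [← Matrix.mul_assoc]
    congr 1
    ext i l
    have := congrArg (fun v : EuclideanSpace ℝ ρ => v i) (hc l)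
    simp only [WithLp.ofLp_sum, WithLp.ofLp_smul, Finset.sum_apply, Pi.smul_apply,
      smul_eq_mul] at this
    simp only [mul_apply, hB₀, of_apply]
    rw [← this]
    exact Finset.sum_congr rfl fun k _ => mul_comm _ _

variable {B : Matrix ρ κ ℝ}

theorem sqNorm_projection_add (hB : (B * Bᵀ) * (B * Bᵀ) = B * Bᵀ) (R S : Matrix ρ γ ℝ) :
    sqNorm ((R - B * Bᵀ * R) + B * Bᵀ * S) = sqNorm (R - B * Bᵀ * R) + sqNorm (B * Bᵀ * S) := by
  have : (R - B * Bᵀ * R)ᵀ * (B * Bᵀ * S) = 0 := by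
    have hs : (B * Bᵀ)ᵀ = B * Bᵀ := by rw [transpose_mul, transpose_transpose]
    have h0 : B * Bᵀ * (R - B * Bᵀ * R) = 0 := by
      rw [Matrix.mul_sub, ← Matrix.mul_assoc (B * Bᵀ) (B * Bᵀ), hB, sub_self]
    rw [← Matrix.mul_assoc, ← hs, ← transpose_mul, hs, h0, transpose_zero, Matrix.zero_mul]
  rw [sqNorm_add, this, trace_zero]; ring

theorem sqNorm_projection_le (hB : (B * Bᵀ) * (B * Bᵀ) = B * Bᵀ) (R : Matrix ρ γ ℝ) :
    sqNorm (B * Bᵀ * R) ≤ sqNorm R := by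
  have := sqNorm_projection_add hB R R
  rw [sub_add_cancel] at this
  linarith [sqNorm_nonneg (R - B * Bᵀ * R)]

/-- A diagonal entry `p` of a projection satisfies `p² ≤ p`, and here `p` is the squared norm of a
row of `B`. -/
theorem abs_le_one_of_projection (hB : (B * Bᵀ) * (B * Bᵀ) = B * Bᵀ) (i : ρ) (k : κ) :
    |B i k| ≤ 1 := by
  have h1 : (B * Bᵀ) i i = ∑ k, B i k ^ 2 := by simp [mul_apply, pow_two]
  have h2 : ((B * Bᵀ) i i) ^ 2 ≤ (B * Bᵀ) i i := by
    have hsymm : ∀ j, (B * Bᵀ) j i = (B * Bᵀ) i j := fun j => by simp [mul_apply, mul_comm]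
    conv_rhs => rw [← hB, mul_apply]
    simp only [hsymm, ← pow_two]
    exact Finset.single_le_sum (f := fun j => (B * Bᵀ) i j ^ 2) (fun j _ => sq_nonneg _)
      (Finset.mem_univ i)
  have h3 : B i k ^ 2 ≤ (B * Bᵀ) i i := by
    rw [h1]
    exact Finset.single_le_sum (f := fun k => B i k ^ 2) (fun j _ => sq_nonneg _)
      (Finset.mem_univ k)
  rw [abs_le_one_iff_mul_self_le_one]
  nlinarith

/-- The infimum is not affected by restricting to pairs `(B, Aᵀ B)` with `B` in a cube: if `B Bᵀ`
projects to the range of `X'`, then `B (Aᵀ B)ᵀ = B Bᵀ A` approximates `A` at least as well as `X'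
Y'ᵀ`. Compactness of the cube gives a minimum. -/
theorem exists_isGlobalMin_blockLoss (A : Matrix ρ γ ℝ) :
    ∃ z : Matrix ρ κ ℝ × Matrix γ κ ℝ, IsGlobalMin (blockLoss A) z := by
  have hK : IsCompact (Set.univ.pi fun _ : ρ => Set.univ.pi fun _ : κ => Set.Icc (-1 : ℝ) 1) :=
    isCompact_univ_pi fun _ => isCompact_univ_pi fun _ => isCompact_Icc
  have hcont : Continuous fun X : ρ → κ → ℝ =>
      blockLoss A ((Matrix.of X : Matrix ρ κ ℝ), Aᵀ * Matrix.of X) := by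
    refine (continuous_blockLoss A).comp ?_
    have : Continuous fun X : ρ → κ → ℝ => (Matrix.of X : Matrix ρ κ ℝ) := continuous_id
    fun_prop
  obtain ⟨X, -, hX⟩ := hK.exists_isMinOn ⟨0, fun i _ k _ => by simp⟩ hcont.continuousOn
  refine ⟨(Matrix.of X, Aᵀ * Matrix.of X), fun ⟨X', Y'⟩ => ?_⟩
  obtain ⟨B, C, hB, hBX, -⟩ := exists_projection X'
  have h1 : blockLoss A (Matrix.of X, Aᵀ * Matrix.of X) ≤ blockLoss A (B, Aᵀ * B) :=
    hX (a := (B : ρ → κ → ℝ))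
      (by intro i _ k _; exact abs_le.1 (abs_le_one_of_projection hB i k))
  refine h1.trans ?_
  have h2 := sqNorm_projection_add hB A (A - X' * Y'ᵀ)
  have e1 : A - B * Bᵀ * A + B * Bᵀ * (A - X' * Y'ᵀ) = A - X' * Y'ᵀ := by
    rw [Matrix.mul_sub, ← Matrix.mul_assoc _ X', hBX]; abel
  rw [e1] at h2
  have e2 : blockLoss A (B, Aᵀ * B) = sqNorm (A - B * Bᵀ * A) := by
    simp [blockLoss, Matrix.mul_assoc]
  rw [e2, blockLoss, h2]
  linarith [sqNorm_nonneg (B * Bᵀ * (A - X' * Y'ᵀ))]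

end Projection

/-! ### Paths to a global minimum in one block -/

section Paths

variable {ρ κ γ : Type*} [Fintype ρ] [Fintype κ] [Fintype γ] {A : Matrix ρ γ ℝ}

theorem isSecondOrderPt_of_not_hasDescentLine {X : Matrix ρ κ ℝ} {Y : Matrix γ κ ℝ}
    (h : ¬ HasDescentLine (blockLoss A) (X, Y)) : IsSecondOrderPt A X Y := by
  by_contra hn
  simp only [IsSecondOrderPt, not_forall] at hn
  obtain ⟨U, V, hUV⟩ := hn
  refine h ⟨(U, V), _, _, _, _, fun t => blockLoss_line A X U Y V t, ?_⟩
  by_contra! hab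
  exact hUV ⟨by linarith [hab.1], hab.2⟩

theorem hasDescentLine_of_not_isGlobalMin {z : Matrix ρ κ ℝ × Matrix γ κ ℝ}
    (h : ¬ IsGlobalMin (blockLoss A) z) : HasDescentLine (blockLoss A) z := by
  classical
  by_contra hn
  exact h (isSecondOrderPt_of_not_hasDescentLine hn).isGlobalMin

theorem isSecondOrderPt_of_isGlobalMin {X : Matrix ρ κ ℝ} {Y : Matrix γ κ ℝ}
    (h : IsGlobalMin (blockLoss A) (X, Y)) : IsSecondOrderPt A X Y := by
  refine isSecondOrderPt_of_not_hasDescentLine fun hd => ?_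
  obtain ⟨w, δ, hδ, hlt⟩ := hd.exists_lt
  exact (hlt (δ / 2) (by positivity) (by linarith)).not_ge (h _)

/-- The loss is convex in `Y` for fixed `X`, so the segment stays in the sublevel set. -/
theorem joinedIn_sublevel_right {X : Matrix ρ κ ℝ} {Y Y' : Matrix γ κ ℝ} {α : ℝ}
    (h : blockLoss A (X, Y) ≤ α) (h' : blockLoss A (X, Y') ≤ α) :
    JoinedIn (sublevel (blockLoss A) α) (X, Y) (X, Y') := by
  have e : (X, Y') = (X, Y) + ((0 : Matrix ρ κ ℝ), Y' - Y) := by simp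
  rw [e]
  refine joinedIn_sublevel_add fun s h0 h1 => ?_
  have e2 : A - ((X, Y) + s • ((0 : Matrix ρ κ ℝ), Y' - Y)).1 *
      ((X, Y) + s • ((0 : Matrix ρ κ ℝ), Y' - Y)).2ᵀ
      = (1 - s) • (A - X * Yᵀ) + s • (A - X * Y'ᵀ) := by
    simp only [Prod.fst_add, Prod.snd_add, Prod.smul_fst, Prod.smul_snd, transpose_add,
      transpose_smul, Matrix.mul_add, Matrix.mul_smul, smul_zero, add_zero, transpose_sub,
      Matrix.mul_sub]
    module
  rw [blockLoss, e2]
  have := sqNorm_convex (A - X * Yᵀ) (A - X * Y'ᵀ) h0 h1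
  simp only [blockLoss] at h h'
  nlinarith

theorem joinedIn_sublevel_interp [DecidableEq κ] {T X : Matrix ρ κ ℝ} {α : ℝ}
    (hT : IsUnit (Tᵀ * T).det) (hX : IsUnit (Tᵀ * X).det)
    (h : ∀ s : ℝ, 0 ≤ s → s ≤ 1 →
      blockLoss A (interp T X s, bestRight A (interp T X s)) ≤ α) :
    JoinedIn (sublevel (blockLoss A) α) (X, bestRight A X)
      (interp T X 0, bestRight A (interp T X 0)) := by
  refine (JoinedIn.ofLine (f := fun s : ℝ => (interp T X s, bestRight A (interp T X s))) ?_ rfl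
    (by rw [interp_one]) ?_).symm
  · have hi : Continuous fun s : ℝ => interp T X s := by unfold interp; fun_prop
    have hinv : Continuous fun s : ℝ => ((interp T X s)ᵀ * interp T X s)⁻¹ := by
      -- The inverse is the adjugate divided by the determinant, which never vanishes along the
      -- path.
      simp only [inv_def, Ring.inverse_eq_inv']
      have hdet : Continuous fun s : ℝ => ((interp T X s)ᵀ * interp T X s).det := by fun_prop
      exact (hdet.inv₀ fun s => (isUnit_gram_interp hT hX s).ne_zero).smul (by fun_prop)
    have : Continuous fun s : ℝ => bestRight A (interp T X s) := by
      unfold bestRight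
      exact (continuous_const.matrix_mul hi).matrix_mul hinv
    exact (hi.prodMk this).continuousOn
  · rintro _ ⟨s, hs, rfl⟩
    exact h s hs.1 hs.2

/-- As the projection fixes `A`, projecting `X` projects the residual, which does not lengthen it;
convexity in `X` covers the segment. -/
theorem joinedIn_sublevel_projection {B X : Matrix ρ κ ℝ} {Y : Matrix γ κ ℝ} {α : ℝ}
    (hB : (B * Bᵀ) * (B * Bᵀ) = B * Bᵀ) (hA : B * Bᵀ * A = A) (h : blockLoss A (X, Y) ≤ α) :
    JoinedIn (sublevel (blockLoss A) α) (X, Y) (B * Bᵀ * X, Y) := by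
  have e : (B * Bᵀ * X, Y) = (X, Y) + (B * Bᵀ * X - X, (0 : Matrix γ κ ℝ)) := by simp
  rw [e]
  refine joinedIn_sublevel_add fun s h0 h1 => ?_
  have e2 : A - ((X, Y) + s • (B * Bᵀ * X - X, (0 : Matrix γ κ ℝ))).1 *
      ((X, Y) + s • (B * Bᵀ * X - X, (0 : Matrix γ κ ℝ))).2ᵀ
      = (1 - s) • (A - X * Yᵀ) + s • (B * Bᵀ * (A - X * Yᵀ)) := by
    simp only [Prod.fst_add, Prod.snd_add, Prod.smul_fst, Prod.smul_snd, smul_zero, add_zero,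
      Matrix.add_mul, Matrix.smul_mul, Matrix.sub_mul, Matrix.mul_sub, hA]
    rw [Matrix.mul_assoc (B * Bᵀ) X]
    module
  rw [blockLoss, e2]
  have := sqNorm_convex (A - X * Yᵀ) (B * Bᵀ * (A - X * Yᵀ)) h0 h1
  have h2 := sqNorm_projection_le hB (A - X * Yᵀ)
  simp only [blockLoss] at h
  nlinarith

/-- The strict inequality leaves room to shift `X` by a small multiple of `T` into general position.
-/
theorem exists_joinedIn_isGlobalMin_of_lt {X T : Matrix ρ κ ℝ} {Y W : Matrix γ κ ℝ} {α : ℝ}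
    [Nonempty κ] (hlt : blockLoss A (X, Y) < α) (hTW : IsGlobalMin (blockLoss A) (T, W)) :
    ∃ z, IsGlobalMin (blockLoss A) z ∧ JoinedIn (sublevel (blockLoss A) α) (X, Y) z := by
  classical
  have hcont : Continuous fun t : ℝ => blockLoss A (X + t • T, Y) :=
    (continuous_blockLoss A).comp (by fun_prop)
  have hopen : {t : ℝ | blockLoss A (X + t • T, Y) < α} ∈ nhds (0 : ℝ) :=
    (isOpen_lt hcont continuous_const).mem_nhds (by simpa using hlt)
  obtain ⟨δ, hδ, hball⟩ := Metric.mem_nhds_iff.1 hopen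
  have hsmall : ∀ t : ℝ, 0 ≤ t → t < δ → blockLoss A (X + t • T, Y) < α := fun t h0 h1 =>
    hball (by simpa [abs_of_nonneg h0] using h1)
  have hshift : ∀ t : ℝ, 0 < t → t < δ →
      JoinedIn (sublevel (blockLoss A) α) (X, Y) (X + t • T, Y) := by
    intro t h0 h1
    have e : (X + t • T, Y) = (X, Y) + (t • T, (0 : Matrix γ κ ℝ)) := by simp
    rw [e]
    refine joinedIn_sublevel_add fun s hs0 hs1 => ?_
    have := hsmall (s * t) (by positivity) (by nlinarith)
    simpa [smul_smul] using this.le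
  have hso := isSecondOrderPt_of_isGlobalMin hTW
  rcases hso.alternative with h0 | ⟨hT, c, hc⟩
  · obtain ⟨B, C, hB, hBT, hBC⟩ := exists_projection T
    have hAT : A = T * Wᵀ := sub_eq_zero.1 h0
    -- Here `A` factors exactly through the range of `T`. Projecting the shifted `X` to that range
    -- gives `T D` with `D` invertible, and `W (D⁻¹)ᵀ` is then an exact right factor.
    have hBA : B * Bᵀ * A = A := by rw [hAT, ← Matrix.mul_assoc, hBT]
    obtain ⟨t, ht0, ht1, ht⟩ := exists_isUnit_det_add_smul (C * (Bᵀ * X)) hδ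
    set D := C * (Bᵀ * X) + t • (1 : Matrix κ κ ℝ) with hD
    have hproj : B * Bᵀ * (X + t • T) = T * D := by
      rw [Matrix.mul_add, Matrix.mul_smul, hBT, hD, Matrix.mul_add, Matrix.mul_smul,
        Matrix.mul_one, ← Matrix.mul_assoc T, ← hBC, Matrix.mul_assoc]
    have hres : A - B * Bᵀ * (X + t • T) * (W * (D⁻¹)ᵀ)ᵀ = 0 := by
      rw [hproj, transpose_mul, transpose_transpose, Matrix.mul_assoc, ← Matrix.mul_assoc D,
        mul_nonsing_inv _ ht, Matrix.one_mul, ← hAT, sub_self]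
    have hmin := isGlobalMin_of_residual_eq_zero hres
    have j1 := joinedIn_sublevel_projection hB hBA (hsmall t ht0.le ht1).le
    refine ⟨_, hmin, ((hshift t ht0 ht1).trans j1).trans
      (joinedIn_sublevel_right j1.target_mem ((hmin _).trans j1.target_mem))⟩
  · obtain ⟨t, ht0, ht1, ht⟩ := exists_isUnit_transpose_mul_add hT X hδ
    have hu := isUnit_gram_interp hT ht 1
    rw [interp_one] at hu
    have hb := (blockLoss_bestRight_le A hu Y).trans (hsmall t ht0.le ht1).le
    refine ⟨_, fun z => (blockLoss_interp_zero_le (W := W) hT ht).trans (hTW z),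
      ((hshift t ht0 ht1).trans (joinedIn_sublevel_right (hsmall t ht0.le ht1).le hb)).trans
      (joinedIn_sublevel_interp hT ht fun s hs0 hs1 => ?_)⟩
    exact (blockLoss_interp_le hT ht hso.left_mul_residual hso.residual_mul_right hc hs0
      hs1).trans hb

/-- Every point is joined to a global minimum of the factorization loss by a path along which the
loss does not exceed its initial value. -/
theorem exists_joinedIn_isGlobalMin_blockLoss (z : Matrix ρ κ ℝ × Matrix γ κ ℝ) :
    ∃ z', IsGlobalMin (blockLoss A) z' ∧
      JoinedIn (sublevel (blockLoss A) (blockLoss A z)) z z' := by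
  by_cases hz : IsGlobalMin (blockLoss A) z
  · exact ⟨z, hz, JoinedIn.refl (le_refl (blockLoss A z))⟩
  have : Nonempty κ := by
    by_contra hκ
    rw [not_nonempty_iff] at hκ
    exact hz fun y => by rw [Subsingleton.elim y z]
  obtain ⟨w, δ, hδ, hlt⟩ := (hasDescentLine_of_not_isGlobalMin hz).exists_lt
  obtain ⟨⟨T, W⟩, hTW⟩ := exists_isGlobalMin_blockLoss (κ := κ) A
  -- A first step along a line of descent provides the strict inequality.
  have hj : JoinedIn (sublevel (blockLoss A) (blockLoss A z)) z (z + (δ / 2) • w) := by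
    refine joinedIn_sublevel_add fun s h0 h1 => ?_
    rcases h0.eq_or_lt with rfl | h0
    · simp
    · rw [smul_smul]
      exact (hlt _ (by positivity) (by nlinarith)).le
  obtain ⟨z', hz', hj'⟩ := exists_joinedIn_isGlobalMin_of_lt
    (hlt (δ / 2) (by positivity) (by linarith)) hTW
  exact ⟨z', hz', hj.trans hj'⟩

end Paths

/-! ### Functions that split into blocks of variables -/

section SumOfBlocks

variable {Q E : Type*} [Fintype Q] [AddCommGroup E] [Module ℝ E] {B : Q → Type*}
  [∀ P, AddCommGroup (B P)] [∀ P, Module ℝ (B P)]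

/-- `F` is, up to a constant, a sum of functions `f P` of complementary blocks of coordinates:
`proj P` reads off a block, and `embed P` fills it, with zeros elsewhere. -/
structure IsSumOfBlocks (F : E → ℝ) (f : ∀ P, B P → ℝ) (proj : ∀ P, E →ₗ[ℝ] B P)
    (embed : ∀ P, B P →ₗ[ℝ] E) : Prop where
  proj_embed : ∀ P v, proj P (embed P v) = v
  proj_embed_of_ne : ∀ P P' v, P' ≠ P → proj P' (embed P v) = 0
  exists_eq : ∃ c, ∀ θ, F θ = c + ∑ P, f P (proj P θ)

namespace IsSumOfBlocks

variable {F : E → ℝ} {f : ∀ P, B P → ℝ} {proj : ∀ P, E →ₗ[ℝ] B P} {embed : ∀ P, B P →ₗ[ℝ] E}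

theorem apply_add_embed (h : IsSumOfBlocks F f proj embed) (θ : E) (P : Q) (v : B P) :
    F (θ + embed P v) = F θ + (f P (proj P θ + v) - f P (proj P θ)) := by
  classical
  obtain ⟨c, hc⟩ := h.exists_eq
  rw [hc, hc, ← Finset.add_sum_erase _ _ (Finset.mem_univ P),
    ← Finset.add_sum_erase _ (fun P => f P (proj P θ)) (Finset.mem_univ P)]
  have : ∑ P' ∈ Finset.univ.erase P, f P' (proj P' (θ + embed P v)) =
      ∑ P' ∈ Finset.univ.erase P, f P' (proj P' θ) := by
    refine Finset.sum_congr rfl fun P' hP' => ?_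
    rw [map_add, h.proj_embed_of_ne P P' v (Finset.ne_of_mem_erase hP'), add_zero]
  rw [this, map_add, h.proj_embed]
  ring

theorem isGlobalMin (h : IsSumOfBlocks F f proj embed) {θ : E}
    (hθ : ∀ P, IsGlobalMin (f P) (proj P θ)) : IsGlobalMin F θ := by
  obtain ⟨c, hc⟩ := h.exists_eq
  intro θ'
  rw [hc, hc]
  gcongr with P
  exact hθ P _

theorem hasDescentLine (h : IsSumOfBlocks F f proj embed)
    (hf : ∀ P z, ¬ IsGlobalMin (f P) z → HasDescentLine (f P) z) {θ : E}
    (hθ : ¬ IsGlobalMin F θ) : HasDescentLine F θ := by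
  have : ∃ P, ¬ IsGlobalMin (f P) (proj P θ) := by
    by_contra! hall
    exact hθ (h.isGlobalMin hall)
  obtain ⟨P, hP⟩ := this
  obtain ⟨v, a, b, c, d, hv, hab⟩ := hf P _ hP
  refine ⟨embed P v, a, b, c, d, fun t => ?_, hab⟩
  rw [← map_smul, h.apply_add_embed, hv]
  ring

theorem exists_joinedIn_isGlobalMin [TopologicalSpace E] [ContinuousAdd E]
    [∀ P, TopologicalSpace (B P)] [∀ P, ContinuousSub (B P)]
    (h : IsSumOfBlocks F f proj embed) (hcont : ∀ P, Continuous (embed P))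
    (hf : ∀ P z, ∃ z', IsGlobalMin (f P) z' ∧ JoinedIn (sublevel (f P) (f P z)) z z') (θ : E) :
    ∃ θ', IsGlobalMin F θ' ∧ JoinedIn (sublevel F (F θ)) θ θ' := by
  classical
  -- The blocks are moved one after another, each along its own path with the other blocks fixed.
  suffices hs : ∀ s : Finset Q, ∃ θ', (∀ P ∈ s, IsGlobalMin (f P) (proj P θ')) ∧
      JoinedIn (sublevel F (F θ)) θ θ' by
    obtain ⟨θ', h1, h2⟩ := hs Finset.univ
    exact ⟨θ', h.isGlobalMin fun P => h1 P (Finset.mem_univ P), h2⟩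
  intro s
  induction s using Finset.induction_on with
  | empty => exact ⟨θ, by simp, JoinedIn.refl (le_refl (F θ))⟩
  | insert P s hP ih =>
    obtain ⟨θ', h1, h2⟩ := ih
    obtain ⟨z', hz', hj⟩ := hf P (proj P θ')
    refine ⟨θ' + embed P (z' - proj P θ'), fun P' hP' => ?_, h2.trans ?_⟩
    · rw [map_add]
      rcases eq_or_ne P' P with rfl | hne
      · rwa [h.proj_embed, add_sub_cancel]
      · rw [h.proj_embed_of_ne P P' _ hne, add_zero]
        exact h1 P' ((Finset.mem_insert.1 hP').resolve_left hne)
    · have hmap : Continuous fun z => θ' + embed P (z - proj P θ') := by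
        have := hcont P
        fun_prop
      have himg := hj.map hmap
      simp only [sub_self, map_zero, add_zero] at himg
      refine himg.mono ?_
      rintro _ ⟨z, hz, rfl⟩
      have hz' : f P z ≤ f P (proj P θ') := hz
      have hθ' : F θ' ≤ F θ := h2.target_mem
      change F (θ' + embed P (z - proj P θ')) ≤ F θ
      rw [h.apply_add_embed, add_sub_cancel]
      linarith

end IsSumOfBlocks

end SumOfBlocks

/-! ### From paths and descent lines to the landscape properties -/

section Landscape

theorem not_isSpuriousLocalValley {E : Type*} [TopologicalSpace E] {F : E → ℝ}
    (hF : ∀ θ, ∃ θ', IsGlobalMin F θ' ∧ JoinedIn (sublevel F (F θ)) θ θ') :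
    ¬ ∃ S : Set E, IsSpuriousLocalValley F S := by
  rintro ⟨S, ⟨α, ⟨hSα, hS⟩, hmax⟩, hno⟩
  obtain ⟨θ, hθ⟩ := hS.nonempty
  obtain ⟨θ', hmin, hj⟩ := hF θ
  have hθα : θ ∈ sublevel F α := hSα hθ
  have hj' : JoinedIn (sublevel F α) θ θ' := hj.mono fun x (hx : F x ≤ F θ) => hx.trans hθα
  have hsub := hmax (y := pathComponentIn (sublevel F α) θ)
    ⟨pathComponentIn_subset, isPathConnected_pathComponentIn hθα⟩
    (hS.subset_pathComponentIn hθ hSα)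
  exact hno θ' (hsub hj') hmin

variable {E : Type*} [NormedAddCommGroup E] [NormedSpace ℝ E]

/-- At a critical point the linear coefficient of the quartic is zero, so `b < 0`, and the Hessian
in the direction `v` equals `2 b`. -/
theorem strictSaddleProperty_of_hasDescentLine {F : E → ℝ} (hF : ContDiff ℝ 2 F)
    (hd : ∀ θ, ¬ IsGlobalMin F θ → HasDescentLine F θ) : StrictSaddleProperty F := by
  have h1 : Differentiable ℝ F := hF.differentiable (by norm_num)
  have h2 : Differentiable ℝ (fderiv ℝ F) :=
    (hF.fderiv_right (m := 1) (by norm_num)).differentiable (by norm_num)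
  refine ⟨h1, h2, fun θ hcrit => or_iff_not_imp_left.2 fun hθ => ⟨hcrit, ?_⟩⟩
  obtain ⟨v, a, b, c, d, hv, hab⟩ := hd θ hθ
  have hline : ∀ t : ℝ, HasDerivAt (fun t : ℝ => θ + t • v) v t := fun t => by
    simpa using ((hasDerivAt_id t).smul_const v).const_add θ
  have hderiv : ∀ t : ℝ, fderiv ℝ F (θ + t • v) v = a + 2 * b * t + 3 * c * t ^ 2
      + 4 * d * t ^ 3 := by
    intro t
    have e1 : HasDerivAt (fun t : ℝ => F (θ + t • v)) (fderiv ℝ F (θ + t • v) v) t :=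
      (h1 (θ + t • v)).hasFDerivAt.comp_hasDerivAt t (hline t)
    have e2 : HasDerivAt (fun t : ℝ => F θ + t * a + t ^ 2 * b + t ^ 3 * c + t ^ 4 * d)
        (a + 2 * b * t + 3 * c * t ^ 2 + 4 * d * t ^ 3) t := by
      have := ((((hasDerivAt_id t).mul_const a).const_add (F θ)).add
        ((hasDerivAt_pow 2 t).mul_const b)).add ((hasDerivAt_pow 3 t).mul_const c) |>.add
        ((hasDerivAt_pow 4 t).mul_const d)
      exact this.congr_deriv (by norm_num; ring)
    rw [← funext hv] at e2
    exact e1.unique e2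
  have ha : a = 0 := by
    have := hderiv 0
    rw [zero_smul, add_zero, show fderiv ℝ F θ = 0 from hcrit] at this
    simpa using this.symm
  have hb : b < 0 := hab.resolve_left (by simp [ha])
  have e3 : HasDerivAt (fun t : ℝ => fderiv ℝ F (θ + t • v) v) (hessian F θ v v) 0 := by
    have e : HasDerivAt (fun t : ℝ => fderiv ℝ F (θ + t • v)) (hessian F θ v) 0 :=
      (h2 θ).hasFDerivAt.comp_hasDerivAt_of_eq 0 (hline 0) (by simp)
    exact (ContinuousLinearMap.apply ℝ ℝ v).hasFDerivAt.comp_hasDerivAt 0 e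
  have e4 : HasDerivAt (fun t : ℝ => a + 2 * b * t + 3 * c * t ^ 2 + 4 * d * t ^ 3)
      (2 * b) 0 := by
    have := ((((hasDerivAt_id (0 : ℝ)).const_mul (2 * b)).const_add a).add
      ((hasDerivAt_pow 2 (0 : ℝ)).const_mul (3 * c))).add
      ((hasDerivAt_pow 3 (0 : ℝ)).const_mul (4 * d))
    exact this.congr_deriv (by norm_num)
  rw [funext hderiv] at e3
  exact ⟨v, by rw [e3.unique e4]; linarith⟩

end Landscape

/-! ### Splitting the constrained loss over the classes of columns -/

section Decomposition

variable {m n r : ℕ} (I : Finset (Fin m × Fin r)) (J : Finset (Fin n × Fin r))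

/-- The pairs of unconstrained factors attached to the class of the column index `k₀`. -/
abbrev ClassBlock (k₀ : Fin r) : Type :=
  Matrix {i // (i, k₀) ∈ I} {k // rankOneSupp I J k = rankOneSupp I J k₀} ℝ ×
    Matrix {j // (j, k₀) ∈ J} {k // rankOneSupp I J k = rankOneSupp I J k₀} ℝ

variable {I J}

theorem leftFactor_add (θ η : Param I J) :
    leftFactor (θ + η) = leftFactor θ + leftFactor η := by
  ext i k
  by_cases h : (i, k) ∈ I <;> simp [leftFactor, h]

theorem leftFactor_smul (t : ℝ) (θ : Param I J) : leftFactor (t • θ) = t • leftFactor θ := by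
  ext i k
  by_cases h : (i, k) ∈ I <;> simp [leftFactor, h]

theorem rightFactor_add (θ η : Param I J) :
    rightFactor (θ + η) = rightFactor θ + rightFactor η := by
  ext j k
  by_cases h : (j, k) ∈ J <;> simp [rightFactor, h]

theorem rightFactor_smul (t : ℝ) (θ : Param I J) : rightFactor (t • θ) = t • rightFactor θ := by
  ext j k
  by_cases h : (j, k) ∈ J <;> simp [rightFactor, h]

variable (I J)

/-- The coefficients of the factors in the class of `k₀`. -/
noncomputable def blockProj (k₀ : Fin r) : Param I J →ₗ[ℝ] ClassBlock I J k₀ where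
  toFun θ := ((leftFactor θ).submatrix Subtype.val Subtype.val,
    (rightFactor θ).submatrix Subtype.val Subtype.val)
  map_add' θ η := by rw [leftFactor_add, rightFactor_add]; rfl
  map_smul' t θ := by rw [leftFactor_smul, rightFactor_smul]; rfl

open Classical in
/-- The parameters with prescribed coefficients in the class of `k₀` and zeros elsewhere. -/
noncomputable def blockEmbed (k₀ : Fin r) : ClassBlock I J k₀ →ₗ[ℝ] Param I J where
  toFun z := WithLp.toLp 2 (Sum.elim
    (fun e => if h : (e.1.1, k₀) ∈ I ∧ rankOneSupp I J e.1.2 = rankOneSupp I J k₀ then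
      z.1 ⟨e.1.1, h.1⟩ ⟨e.1.2, h.2⟩ else 0)
    (fun e => if h : (e.1.1, k₀) ∈ J ∧ rankOneSupp I J e.1.2 = rankOneSupp I J k₀ then
      z.2 ⟨e.1.1, h.1⟩ ⟨e.1.2, h.2⟩ else 0))
  map_add' z w := by
    ext (e | e)
    · simp only [PiLp.add_apply, Sum.elim_inl]
      split_ifs <;> simp
    · simp only [PiLp.add_apply, Sum.elim_inr]
      split_ifs <;> simp
  map_smul' t z := by
    ext (e | e)
    · simp only [PiLp.smul_apply, Sum.elim_inl]
      split_ifs <;> simp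
    · simp only [PiLp.smul_apply, Sum.elim_inr]
      split_ifs <;> simp

theorem continuous_blockEmbed (k₀ : Fin r) : Continuous (blockEmbed I J k₀) :=
  LinearMap.continuous_of_finiteDimensional _

variable {I J}

/-- A product set determines its factors only when it is nonempty. For this reason classes with
empty support are left out of the blocks; they contribute nothing to `X Yᵀ`. -/
theorem mem_iff_of_rankOneSupp_eq {k k₀ : Fin r} (hne : (rankOneSupp I J k₀).Nonempty)
    (h : rankOneSupp I J k = rankOneSupp I J k₀) :
    (∀ i, (i, k) ∈ I ↔ (i, k₀) ∈ I) ∧ ∀ j, (j, k) ∈ J ↔ (j, k₀) ∈ J := by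
  rw [← h] at hne
  obtain ⟨h1, h2⟩ := (Set.prod_eq_prod_iff_of_nonempty hne).1 h
  exact ⟨fun i => Set.ext_iff.1 h1 i, fun j => Set.ext_iff.1 h2 j⟩

theorem blockProj_blockEmbed {k₀ : Fin r} (hne : (rankOneSupp I J k₀).Nonempty)
    (z : ClassBlock I J k₀) : blockProj I J k₀ (blockEmbed I J k₀ z) = z := by
  refine Prod.ext ?_ ?_
  · ext ⟨i, hi⟩ ⟨k, hk⟩
    have := ((mem_iff_of_rankOneSupp_eq hne hk).1 i).2 hi
    simp [blockProj, blockEmbed, leftFactor, this, hi, hk]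
  · ext ⟨j, hj⟩ ⟨k, hk⟩
    have := ((mem_iff_of_rankOneSupp_eq hne hk).2 j).2 hj
    simp [blockProj, blockEmbed, rightFactor, this, hj, hk]

theorem blockProj_blockEmbed_of_ne {k₀ k₁ : Fin r}
    (hne : rankOneSupp I J k₁ ≠ rankOneSupp I J k₀) (z : ClassBlock I J k₀) :
    blockProj I J k₁ (blockEmbed I J k₀ z) = 0 := by
  refine Prod.ext ?_ ?_
  · ext ⟨i, hi⟩ ⟨k, hk⟩
    simp [blockProj, blockEmbed, leftFactor, hk, hne]
  · ext ⟨j, hj⟩ ⟨k, hk⟩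
    simp [blockProj, blockEmbed, rightFactor, hk, hne]

theorem DisjointSupports.eq_of_mem (hIJ : DisjointSupports I J) {k l : Fin r}
    {e : Fin m × Fin n} (hk : e ∈ rankOneSupp I J k) (hl : e ∈ rankOneSupp I J l) :
    rankOneSupp I J k = rankOneSupp I J l := by
  by_contra hne
  have := hIJ (Quotient.mk _ k) (Quotient.mk _ l) fun h => hne (Quotient.exact h)
  exact (Set.ext_iff.1 this e).1 ⟨hk, hl⟩

theorem leftFactor_mul_rightFactor_eq_zero (θ : Param I J) {i : Fin m} {j : Fin n} {k : Fin r}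
    (h : (i, j) ∉ rankOneSupp I J k) : leftFactor θ i k * rightFactor θ j k = 0 := by
  by_cases hi : (i, k) ∈ I
  · have hj : (j, k) ∉ J := fun hj => h ⟨hi, hj⟩
    simp [rightFactor, hj]
  · simp [leftFactor, hi]

theorem sum_subtype_eq_sum_ite {α : Type*} [Fintype α] (p : α → Prop) [DecidablePred p]
    [Fintype {x // p x}] (g : α → ℝ) :
    ∑ x : {x // p x}, g x = ∑ x, if p x then g x else 0 := by
  rw [← Finset.sum_filter]
  exact (Finset.sum_subtype _ (by simp) g).symm

/-- A column outside the class contributes zero at `(i, j)`, since otherwise `(i, j)` would lie in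
two distinct supports. -/
theorem product_apply_of_mem (hIJ : DisjointSupports I J) (θ : Param I J) (k₀ : Fin r)
    (i : {i // (i, k₀) ∈ I}) (j : {j // (j, k₀) ∈ J}) :
    ((blockProj I J k₀ θ).1 * (blockProj I J k₀ θ).2ᵀ) i j =
      (leftFactor θ * (rightFactor θ)ᵀ) i.1 j.1 := by
  classical
  simp only [mul_apply, transpose_apply, blockProj, LinearMap.coe_mk, AddHom.coe_mk,
    submatrix_apply]
  rw [sum_subtype_eq_sum_ite (fun k => rankOneSupp I J k = rankOneSupp I J k₀)
    fun k => leftFactor θ i.1 k * rightFactor θ j.1 k]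
  refine Finset.sum_congr rfl fun k _ => ?_
  split_ifs with hk
  · rfl
  · exact (leftFactor_mul_rightFactor_eq_zero θ fun hmem =>
      hk (hIJ.eq_of_mem hmem ⟨i.2, j.2⟩)).symm

/-- The classes whose rank-one support is not empty. -/
abbrev SuppClass (I : Finset (Fin m × Fin r)) (J : Finset (Fin n × Fin r)) : Type :=
  {P : Quotient (suppSetoid I J) // (rankOneSupp I J P.out).Nonempty}

theorem SuppClass.eq_of_rankOneSupp_eq {P P' : SuppClass I J}
    (h : rankOneSupp I J P.1.out = rankOneSupp I J P'.1.out) : P = P' :=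
  Subtype.ext (by
    rw [← Quotient.out_eq P.1, ← Quotient.out_eq P'.1]
    exact Quotient.sound h)

theorem SuppClass.exists_mem {k : Fin r} {e : Fin m × Fin n} (h : e ∈ rankOneSupp I J k) :
    ∃ P : SuppClass I J, e ∈ rankOneSupp I J P.1.out := by
  have : rankOneSupp I J (Quotient.mk (suppSetoid I J) k).out = rankOneSupp I J k :=
    Quotient.mk_out (s := suppSetoid I J) k
  rw [← this] at h
  exact ⟨⟨_, ⟨e, h⟩⟩, h⟩

noncomputable instance : Fintype (SuppClass I J) := Fintype.ofFinite _

theorem sum_block_eq (k₀ : Fin r) (g : Fin m → Fin n → ℝ) :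
    ∑ i : {i // (i, k₀) ∈ I}, ∑ j : {j // (j, k₀) ∈ J}, g i j =
      ∑ i, ∑ j, (rankOneSupp I J k₀).indicator (fun e => g e.1 e.2) (i, j) := by
  classical
  rw [sum_subtype_eq_sum_ite (fun i => (i, k₀) ∈ I) fun i => ∑ j : {j // (j, k₀) ∈ J}, g i j]
  refine Finset.sum_congr rfl fun i _ => ?_
  rw [sum_subtype_eq_sum_ite (fun j => (j, k₀) ∈ J) (g i)]
  by_cases hi : (i, k₀) ∈ I <;> simp [rankOneSupp, Set.indicator_apply, hi]

theorem isSumOfBlocks_loss (hIJ : DisjointSupports I J) (A : Matrix (Fin m) (Fin n) ℝ) :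
    IsSumOfBlocks (loss I J A)
      (fun P : SuppClass I J => (blockLoss (A.submatrix Subtype.val Subtype.val) :
        ClassBlock I J P.1.out → ℝ))
      (fun P => blockProj I J P.1.out) (fun P => blockEmbed I J P.1.out) where
  proj_embed P v := blockProj_blockEmbed P.2 v
  proj_embed_of_ne P P' v hne :=
    blockProj_blockEmbed_of_ne (fun h => hne (SuppClass.eq_of_rankOneSupp_eq h)) v
  exists_eq := by
    classical
    -- The constant collects the entries of `A` outside all supports, which no choice of factors can
    -- reach.
    refine ⟨∑ i, ∑ j, if ∃ P : SuppClass I J, (i, j) ∈ rankOneSupp I J P.1.out then 0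
      else A i j ^ 2, fun θ => ?_⟩
    have hblock : ∀ P : SuppClass I J,
        blockLoss (A.submatrix Subtype.val Subtype.val) (blockProj I J P.1.out θ) =
        ∑ i, ∑ j, (rankOneSupp I J P.1.out).indicator
          (fun e => (A - leftFactor θ * (rightFactor θ)ᵀ) e.1 e.2 ^ 2) (i, j) := by
      intro P
      rw [blockLoss, sqNorm_eq_sum,
        ← sum_block_eq _ fun i j => (A - leftFactor θ * (rightFactor θ)ᵀ) i j ^ 2]
      simp only [Matrix.sub_apply, product_apply_of_mem hIJ, submatrix_apply]
    simp only [hblock]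
    rw [Finset.sum_comm (s := (Finset.univ : Finset (SuppClass I J))), loss, frobSq,
      ← Finset.sum_add_distrib]
    refine Finset.sum_congr rfl fun i _ => ?_
    rw [Finset.sum_comm (s := (Finset.univ : Finset (SuppClass I J))), ← Finset.sum_add_distrib]
    refine Finset.sum_congr rfl fun j _ => ?_
    by_cases h : ∃ P : SuppClass I J, (i, j) ∈ rankOneSupp I J P.1.out
    · obtain ⟨P, hP⟩ := h
      rw [if_pos ⟨P, hP⟩, zero_add, Finset.sum_eq_single P, Set.indicator_of_mem hP]
      · intro P' _ hne
        refine Set.indicator_of_notMem (fun hP' => hne ?_) _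
        exact SuppClass.eq_of_rankOneSupp_eq (hIJ.eq_of_mem hP' hP)
      · simp
    · rw [if_neg h, Finset.sum_eq_zero, add_zero]
      · have : (leftFactor θ * (rightFactor θ)ᵀ) i j = 0 := by
          rw [mul_apply]
          refine Finset.sum_eq_zero fun k _ => leftFactor_mul_rightFactor_eq_zero θ fun hk => ?_
          exact h (SuppClass.exists_mem hk)
        rw [Matrix.sub_apply, this, sub_zero]
      · intro P _
        exact Set.indicator_of_notMem (fun hP => h ⟨P, hP⟩) _

theorem contDiff_loss (A : Matrix (Fin m) (Fin n) ℝ) : ContDiff ℝ 2 (loss I J A) := by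
  have hl : ∀ i k, ContDiff ℝ 2 fun θ : Param I J => leftFactor θ i k := by
    intro i k
    by_cases h : (i, k) ∈ I
    · simp only [leftFactor, of_apply, h, dif_pos]; fun_prop
    · simp only [leftFactor, of_apply, h, dif_neg, not_false_iff]; fun_prop
  have hr : ∀ j k, ContDiff ℝ 2 fun θ : Param I J => rightFactor θ j k := by
    intro j k
    by_cases h : (j, k) ∈ J
    · simp only [rightFactor, of_apply, h, dif_pos]; fun_prop
    · simp only [rightFactor, of_apply, h, dif_neg, not_false_iff]; fun_prop
  unfold loss frobSq
  simp only [Matrix.sub_apply, mul_apply, transpose_apply]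
  fun_prop

end Decomposition

end FSMF

theorem mainTheorem4 {m n r : ℕ} (I : Finset (Fin m × Fin r)) (J : Finset (Fin n × Fin r))
    (hIJ : FSMF.DisjointSupports I J) (A : Matrix (Fin m) (Fin n) ℝ) :
    (¬ ∃ S : Set (FSMF.Param I J), FSMF.IsSpuriousLocalValley (FSMF.loss I J A) S) ∧
    FSMF.StrictSaddleProperty (FSMF.loss I J A) ∧
    (¬ ∃ θ : FSMF.Param I J, FSMF.IsSpuriousLocalMin (FSMF.loss I J A) θ) := by
  have h := FSMF.isSumOfBlocks_loss hIJ A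
  have hd : ∀ θ, ¬ FSMF.IsGlobalMin (FSMF.loss I J A) θ →
      FSMF.HasDescentLine (FSMF.loss I J A) θ := fun θ hθ =>
    h.hasDescentLine (fun P z hz => FSMF.hasDescentLine_of_not_isGlobalMin hz) hθ
  refine ⟨FSMF.not_isSpuriousLocalValley fun θ => h.exists_joinedIn_isGlobalMin
    (fun P => FSMF.continuous_blockEmbed I J P.1.out)
    (fun P z => FSMF.exists_joinedIn_isGlobalMin_blockLoss z) θ,
    FSMF.strictSaddleProperty_of_hasDescentLine (FSMF.contDiff_loss A) hd, ?_⟩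
  rintro ⟨θ, hloc, hθ⟩
  exact (hd θ hθ).not_isLocalMin hloc
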